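/- A semigroup $S$ is nilpotent if $|S^{c+1}|=1$ for some integer $c\ge 0$; the least such $c$ is its class, and if $S$ is finite its coclass is $|S|-1-c$. Two semigroups are (anti-)isomorphic if one is isomorphic to the other or to the dual of the other; a semigroup is self-dual if it is isomorphic to its dual. Let $n\ge 7$. The following is a complete and irredundant list, up to (anti-)isomorphism, of the nilpotent semigroups of order $n$ and coclass $2$ that have a minimal generating set of size $2$. That is, every semigroup in the list is of this kind, every semigroup of this kind is (anti-)isomorphic to one in the list, and no two different entries of the list are (anti-)isomorphic. \begin{align*} &T_{1,i} =\langle u,v \mid u^{n-2}=u^{n-1},\ uv = vu,\ v^2 = uv,\ v^3 = u^{n-i}\rangle, && i\in\{2,3\};\\ &T_{2,k} =\langle u,v \mid u^{n-2}=u^{n-1},\ uv = vu,\ v^2 = u^{2k-4},\ u^2v = u^k \rangle, && 3 \leq k < n/2;\\ &T_{2,i,k} =\langle u,v \mid u^{n-2}=u^{n-1},\ uv = vu,\ v^2 = u^{n-i},\ u^2v = u^k \rangle, && n/2 \leq k \leq n-2,\ i \in\{2,3,4\};\\ &T_{3} =\langle u,v \mid u^{n-2}=u^{n-1},\ v^2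 = uv,\ vu = u^2,\ uv^2 = u^3 \rangle;\\ &T_{3,i} =\langle u,v \mid u^{n-2}=u^{n-1},\ v^2 = uv,\ vu = u^{n-i},\ uv^2 = u^{n-2} \rangle, && i \in\{2,3\};\\ &T_{4,k} =\langle u,v \mid u^{n-2}=u^{n-1},\ uv = vu,\ uv = u^k,\ v^3 = u^{3k-3}\rangle, && 2 \leq k < n/3;\\ &T_{4,i,k} =\langle u,v \mid u^{n-2}=u^{n-1},\ uv = vu,\ uv = u^k,\ v^3 = u^{n-i}\rangle, && n/3 \leq k \leq n-4,\ i\in\{2,3\};\\ &T_{4,i,j,k} =\langle u,v \mid u^{n-2}=u^{n-1},\ uv = u^{n-i},\ vu = u^{n-j},\ v^3 = u^{n-k}\rangle, && i,j,k\in\{2,3\},\ i\le j;\\ &T_{5,k} =\langle u,v \mid u^{n-2}=u^{n-1},\ uv = u^k,\ v^2 = u^{2k-2},\ vu^2 = u^{k+1}\rangle, && 2 \leq k < (n-1)/2;\\ &T_{5,i,k} =\langle u,v \mid u^{n-2}=u^{n-1},\ uv = u^k,\ v^2 = u^{n-i},\ vu^2 = u^{k+1}\rangle, && (n-1)/2 \leq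 k \leq n-5,\ i\in\{2,3\};\\ &T_{5,i,j,k} =\langle u,v \mid u^{n-2}=u^{n-1},\ uv = u^{n-i},\ v^2 = u^{n-j},\ vu^2 = u^{n-k} \rangle, && i\in\{2,3,4\},\ j,k\in\{2,3\}. \end{align*} A semigroup from the list is self-dual if and only if it is commutative or is $T_{5,2}$. (Here the parameters $i,j,k$ are integers, and $n/2$, $n/3$, $(n-1)/2$ are rational numbers.) -/

import Mathlib

open scoped Pointwise

namespace NilSemigroup

universe w

section General

/-- `powSucc S k` is the set `S^(k+1)` of all products of `k + 1` elements of `S`. -/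
def powSucc (S : Type w) [Mul S] : ℕ → Set S
  | 0 => Set.univ
  | k + 1 => powSucc S k * Set.univ

/-- `S` is nilpotent if `|S^(c+1)| = 1` for some natural number `c` (possibly zero). -/
def IsNilpotent (S : Type w) [Mul S] : Prop :=
  ∃ c : ℕ, (powSucc S c).ncard = 1

/-- The nilpotency class: the least `c` with `|S^(c+1)| = 1` (meaningful for nilpotent `S`). -/
noncomputable def nilpotencyClass (S : Type w) [Mul S] : ℕ :=
  sInf {c : ℕ | (powSucc S c).ncard = 1}

/-- `S` is a finite nilpotent semigroup of coclass `r`, i.e. `r = |S| - 1 - c` where `c` is the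
nilpotency class of `S`. -/
def HasCoclass (S : Type w) [Mul S] (r : ℕ) : Prop :=
  Finite S ∧ IsNilpotent S ∧ Nat.card S = r + 1 + nilpotencyClass S

/-- `A` is a minimal (with respect to inclusion) generating set of `S`. -/
def IsMinimalGenerating {S : Type w} [Mul S] (A : Set S) : Prop :=
  Minimal (fun B : Set S => Subsemigroup.closure B = ⊤) A

/-- The semigroups to be classified: nilpotent of order `n` and coclass `2`, with a minimal
generating set of size `2`. -/
def IsCoclassTwoTwoGenerated (n : ℕ) (S : Type w) [Mul S] : Prop :=
  Nat.card S = n ∧ HasCoclass S 2 ∧ ∃ A : Set S, IsMinimalGenerating A ∧ A.ncard = 2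

/-- `S` and `T` are isomorphic or anti-isomorphic. -/
def IsoOrAntiIso (S : Type*) (T : Type*) [Mul S] [Mul T] : Prop :=
  Nonempty (S ≃* T) ∨ Nonempty (S ≃* Tᵐᵒᵖ)

/-- `S` is isomorphic to its dual. -/
def IsSelfDual (S : Type w) [Mul S] : Prop :=
  Nonempty (S ≃* Sᵐᵒᵖ)

/-- The power `x^k` for `k ≥ 1`. A semigroup has no zeroth power; the value at `k = 0` is a
placeholder that is never used. -/
def spow {S : Type w} [Mul S] (x : S) : ℕ → S
  | 0 => x
  | 1 => x
  | k + 2 => spow x (k + 1) * x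

/-- The semigroup `⟨α | rels⟩`: the quotient of the free semigroup on `α` by the congruence
generated by the pairs in `rels`. -/
def Presented {α : Type w} (rels : Set (FreeSemigroup α × FreeSemigroup α)) : Type w :=
  (conGen fun a b => (a, b) ∈ rels).Quotient

instance {α : Type w} (rels : Set (FreeSemigroup α × FreeSemigroup α)) :
    Semigroup (Presented rels) :=
  inferInstanceAs (Semigroup (conGen fun a b => (a, b) ∈ rels).Quotient)

end General

/-- The names of the presentations: `T1 i` is `T_{1,i}`, `T2 k` is `T_{2,k}`, `T2' i k` is
`T_{2,i,k}`, `T3` is `T_3`, `T3' i` is `T_{3,i}`, `T4 k` is `T_{4,k}`, `T4' i k` is `T_{4,i,k}`,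
`T4'' i j k` is `T_{4,i,j,k}`, `T5 k` is `T_{5,k}`, `T5' i k` is `T_{5,i,k}` and
`T5'' i j k` is `T_{5,i,j,k}`. -/
inductive Name : Type
  | T1 (i : ℕ)
  | T2 (k : ℕ)
  | T2' (i k : ℕ)
  | T3
  | T3' (i : ℕ)
  | T4 (k : ℕ)
  | T4' (i k : ℕ)
  | T4'' (i j k : ℕ)
  | T5 (k : ℕ)
  | T5' (i k : ℕ)
  | T5'' (i j k : ℕ)

/-- The ranges of the parameters in the list for order `n`. The bounds `n/2`, `n/3` and
`(n-1)/2` are rational numbers; the inequalities are stated with denominators cleared. -/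
def Name.InList (n : ℕ) : Name → Prop
  | .T1 i => i = 2 ∨ i = 3
  | .T2 k => 3 ≤ k ∧ 2 * k < n
  | .T2' i k => (n ≤ 2 * k ∧ k ≤ n - 2) ∧ (i = 2 ∨ i = 3 ∨ i = 4)
  | .T3 => True
  | .T3' i => i = 2 ∨ i = 3
  | .T4 k => 2 ≤ k ∧ 3 * k < n
  | .T4' i k => (n ≤ 3 * k ∧ k ≤ n - 4) ∧ (i = 2 ∨ i = 3)
  | .T4'' i j k => (i = 2 ∨ i = 3) ∧ (j = 2 ∨ j = 3) ∧ i ≤ j ∧ (k = 2 ∨ k = 3)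
  | .T5 k => 2 ≤ k ∧ 2 * k < n - 1
  | .T5' i k => (n - 1 ≤ 2 * k ∧ k ≤ n - 5) ∧ (i = 2 ∨ i = 3)
  | .T5'' i j k => (i = 2 ∨ i = 3 ∨ i = 4) ∧ (j = 2 ∨ j = 3) ∧ (k = 2 ∨ k = 3)

/-- The free semigroup on two letters. -/
abbrev Word : Type := FreeSemigroup (Fin 2)

/-- The first letter. -/
def u : Word := FreeSemigroup.of 0

/-- The second letter. -/
def v : Word := FreeSemigroup.of 1

/-- The defining relations of each presentation, apart from `u^(n-2) = u^(n-1)`. -/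
def Name.extraRels (n : ℕ) : Name → Set (Word × Word)
  | .T1 i => {(u * v, v * u), (spow v 2, u * v), (spow v 3, spow u (n - i))}
  | .T2 k => {(u * v, v * u), (spow v 2, spow u (2 * k - 4)), (spow u 2 * v, spow u k)}
  | .T2' i k => {(u * v, v * u), (spow v 2, spow u (n - i)), (spow u 2 * v, spow u k)}
  | .T3 => {(spow v 2, u * v), (v * u, spow u 2), (u * spow v 2, spow u 3)}
  | .T3' i => {(spow v 2, u * v), (v * u, spow u (n - i)), (u * spow v 2, spow u (n - 2))}
  | .T4 k => {(u * v, v * u), (u * v, spow u k), (spow v 3, spow u (3 * k - 3))}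
  | .T4' i k => {(u * v, v * u), (u * v, spow u k), (spow v 3, spow u (n - i))}
  | .T4'' i j k =>
      {(u * v, spow u (n - i)), (v * u, spow u (n - j)), (spow v 3, spow u (n - k))}
  | .T5 k =>
      {(u * v, spow u k), (spow v 2, spow u (2 * k - 2)), (v * spow u 2, spow u (k + 1))}
  | .T5' i k =>
      {(u * v, spow u k), (spow v 2, spow u (n - i)), (v * spow u 2, spow u (k + 1))}
  | .T5'' i j k =>
      {(u * v, spow u (n - i)), (spow v 2, spow u (n - j)), (v * spow u 2, spow u (n - k))}

/-- The semigroup with the given name in the list for order `n`. -/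
abbrev T (n : ℕ) (p : Name) : Type :=
  Presented (insert (spow u (n - 2), spow u (n - 1)) (p.extraRels n))

end NilSemigroup

set_option linter.unusedSimpArgs false

namespace NilSemigroup

/-! ### Powers and their stabilisation -/

section Powers

variable {S : Type*} [Semigroup S]

/-! Put N = n - 2, so N ≥ 5. Each entry is read as a pair of generators with u^N = u^(N+1) and
relations of one of five shapes (`Pat`). `Pat.Valid` collects the constraints on the exponents, and
`Name.InList.eq_of_pat_eq` and `Pat.Valid.exists_name` match the entries with the valid shapes,
where j ≤ i is imposed in `P4`.

Order and class: the relations rewrite every product to a power u, ..., u^N, to v, or to one further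
product x of the generators. To see that these N + 2 elements are distinct, let the generators act
on the right on their formal names, with an identity adjoined. The action satisfies the relations
(`Pat.Valid.sat_trans`), and the images of the identity separate the elements (`Name.model`). Since
x and v drop out after two factors, the class is governed by the powers of u.

Irredundance: the generators are the only elements that are not products, so an (anti-)isomorphism
permutes them. If u goes to u, the multiplication tables are compared. If the generators are
exchanged, v also has long nonconstant powers, which leaves four shapes, told apart by whether uv =
vu and whether u² = v². The same dichotomy for one semigroup settles self-duality.

Completeness: in a semigroup of the given kind the differences S^k \ S^(k+1), for k from 1 to N - 1,
are nonempty and have N + 1 elements in total. Their sizes must be 2, 2, 1, ..., 1, and S^3 consists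
of powers of one generator a (`exists_layered`). So each of ab, ba, b² is a power of a or the
remaining element x, and associativity on short words gives equations between exponents that amount
to `Pat.Valid`. A surjection from the presented semigroup onto one of the same finite order is an
isomorphism (`Name.nonempty_mulEquiv`). -/

theorem spow_one (x : S) : spow x 1 = x := rfl

theorem spow_two (x : S) : spow x 2 = x * x := rfl

theorem spow_three (x : S) : spow x 3 = x * x * x := rfl

theorem spow_succ (x : S) {a : ℕ} (ha : 1 ≤ a) : spow x (a + 1) = spow x a * x := by
  obtain ⟨k, rfl⟩ := Nat.exists_eq_add_of_le' ha
  rfl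

theorem spow_add (x : S) {a b : ℕ} (ha : 1 ≤ a) (hb : 1 ≤ b) :
    spow x (a + b) = spow x a * spow x b := by
  induction b, hb using Nat.le_induction with
  | base => exact spow_succ x ha
  | succ b hb ih => rw [← add_assoc, spow_succ x (by omega), ih, spow_succ x hb, mul_assoc]

theorem spow_succ' (x : S) {a : ℕ} (ha : 1 ≤ a) : spow x (a + 1) = x * spow x a := by
  rw [add_comm, spow_add x le_rfl ha, spow_one]

theorem map_spow {S' F : Type*} [Semigroup S'] [FunLike F S S'] [MulHomClass F S S'] (f : F)
    (x : S) (a : ℕ) : f (spow x a) = spow (f x) a := by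
  rcases Nat.eq_zero_or_pos a with rfl | ha
  · rfl
  induction a, ha using Nat.le_induction with
  | base => rfl
  | succ a ha ih => rw [spow_succ _ ha, map_mul, ih, spow_succ _ ha]

theorem op_spow (x : S) (a : ℕ) : MulOpposite.op (spow x a) = spow (MulOpposite.op x) a := by
  rcases Nat.eq_zero_or_pos a with rfl | ha
  · rfl
  induction a, ha using Nat.le_induction with
  | base => rfl
  | succ a ha ih => rw [spow_succ' _ ha, MulOpposite.op_mul, ih, spow_succ _ ha]

theorem spow_eq_of_le {x : S} {N : ℕ} (hN : 1 ≤ N) (h : spow x N = spow x (N + 1)) {a : ℕ}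
    (ha : N ≤ a) : spow x a = spow x N := by
  induction a, ha using Nat.le_induction with
  | base => rfl
  | succ a ha ih => rw [spow_succ _ (hN.trans ha), ih, ← spow_succ _ hN, h]

theorem spow_min {x : S} {N : ℕ} (hN : 1 ≤ N) (h : spow x N = spow x (N + 1)) (a : ℕ) :
    spow x (min a N) = spow x a := by
  rcases le_total a N with ha | ha
  · rw [min_eq_left ha]
  · rw [min_eq_right ha, spow_eq_of_le hN h ha]

end Powers

/-! ### Universal property of a presentation -/

section Universal

variable {α : Type*} {rels : Set (FreeSemigroup α × FreeSemigroup α)}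

/-- The canonical map from words to the presented semigroup. -/
def Presented.mk (rels : Set (FreeSemigroup α × FreeSemigroup α)) :
    FreeSemigroup α →ₙ* Presented rels :=
  (conGen fun a b => (a, b) ∈ rels).mkMulHom

theorem Presented.mk_surjective : Function.Surjective (Presented.mk rels) := by
  intro q
  induction q using Quotient.inductionOn' with
  | h w => exact ⟨w, rfl⟩

theorem Presented.mk_eq {r : FreeSemigroup α × FreeSemigroup α} (hr : r ∈ rels) :
    Presented.mk rels r.1 = Presented.mk rels r.2 :=
  (Con.eq _).2 (ConGen.Rel.of _ _ hr)

theorem Presented.exists_lift {S : Type*} [Semigroup S] (f : FreeSemigroup α →ₙ* S)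
    (hf : ∀ r ∈ rels, f r.1 = f r.2) :
    ∃ g : Presented rels →ₙ* S, ∀ w, g (Presented.mk rels w) = f w := by
  have h : conGen (fun a b => (a, b) ∈ rels) ≤ Con.ker f :=
    Con.conGen_le.2 fun a b hab => hf (a, b) hab
  refine ⟨⟨fun q => Con.liftOn q f fun a b hab => h hab, ?_⟩, fun w => rfl⟩
  intro p q
  obtain ⟨a, rfl⟩ := Presented.mk_surjective p
  obtain ⟨b, rfl⟩ := Presented.mk_surjective q
  rw [← map_mul]
  exact map_mul f a b

end Universal

/-! ### The five shapes of relations and the names in the list -/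

/-- The shapes of the relations besides `u^N = u^(N+1)`. -/
inductive Pat : Type
  | P1 (m : ℕ)
  | P2 (j k : ℕ)
  | P3 (j k : ℕ)
  | P4 (i j m : ℕ)
  | P5 (i j m : ℕ)

/-- The relations of a shape, evaluated at a pair of elements. -/
def Pat.Rel {S : Type*} [Semigroup S] (a b : S) : Pat → Prop
  | .P1 m => a * b = b * a ∧ b * b = a * b ∧ b * b * b = spow a m
  | .P2 j k => a * b = b * a ∧ b * b = spow a j ∧ a * a * b = spow a k
  | .P3 j k => b * b = a * b ∧ b * a = spow a j ∧ a * (b * b) = spow a k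
  | .P4 i j m => a * b = spow a i ∧ b * a = spow a j ∧ b * b * b = spow a m
  | .P5 i j m => a * b = spow a i ∧ b * b = spow a j ∧ b * (a * a) = spow a m

/-- `a` and `b` satisfy all relations of the shape. -/
def Pat.Sat {S : Type*} [Semigroup S] (N : ℕ) (a b : S) (P : Pat) : Prop :=
  spow a N = spow a (N + 1) ∧ P.Rel a b

/-- The parameters for which the shape defines a semigroup of order `N + 2`. -/
def Pat.Valid (N : ℕ) : Pat → Prop
  | .P1 m => N ≤ m + 1 ∧ m ≤ N
  | .P2 j k => 2 ≤ j ∧ j ≤ N ∧ 3 ≤ k ∧ k ≤ N ∧ (j + 4 = 2 * k ∨ N ≤ j + 2 ∧ N + 2 ≤ 2 * k)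
  | .P3 j k => j = 2 ∧ k = 3 ∨ N ≤ j + 1 ∧ j ≤ N ∧ k = N
  | .P4 i j m => 2 ≤ i ∧ i ≤ N ∧ 2 ≤ j ∧ j ≤ N ∧ m ≤ N ∧ (i = j ∨ N ≤ i + 1 ∧ N ≤ j + 1) ∧
      (m + 3 = 3 * i ∨ N ≤ m + 1 ∧ N + 2 ≤ 3 * i)
  | .P5 i j m => 2 ≤ i ∧ i ≤ N ∧ j ≤ N ∧ 3 ≤ m ∧ m ≤ N ∧
      (m = i + 1 ∨ N ≤ i + 2 ∧ N ≤ m + 1) ∧ (j + 2 = 2 * i ∨ N ≤ j + 1 ∧ N + 1 ≤ 2 * i)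

/-- The shape of a name in the list. -/
def Name.pat (n : ℕ) : Name → Pat
  | .T1 i => .P1 (n - i)
  | .T2 k => .P2 (2 * k - 4) k
  | .T2' i k => .P2 (n - i) k
  | .T3 => .P3 2 3
  | .T3' i => .P3 (n - i) (n - 2)
  | .T4 k => .P4 k k (3 * k - 3)
  | .T4' i k => .P4 k k (n - i)
  | .T4'' i j k => .P4 (n - i) (n - j) (n - k)
  | .T5 k => .P5 k (2 * k - 2) (k + 1)
  | .T5' i k => .P5 k (n - i) (k + 1)
  | .T5'' i j k => .P5 (n - i) (n - j) (n - k)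

theorem Name.InList.valid {N : ℕ} (hN : 5 ≤ N) {p : Name} (hp : p.InList (N + 2)) :
    (p.pat (N + 2)).Valid N := by
  cases p <;> simp only [Name.InList, Name.pat, Pat.Valid, true_or, true_and, and_true] at hp ⊢ <;> omega

/-- The condition `i ≤ j` on the name turns around because the exponents are `n - i` and `n - j`. It
selects one member of each dual pair of shape `P4`. -/
theorem Name.InList.le_of_pat_eq {N : ℕ} {p : Name} (hp : p.InList (N + 2))
    {i j m : ℕ} (h : p.pat (N + 2) = .P4 i j m) : j ≤ i := by
  cases p <;> simp only [Name.InList, Name.pat, Pat.P4.injEq, reduceCtorEq] at hp h <;> omega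

theorem Name.InList.eq_of_pat_eq {N : ℕ} (hN : 5 ≤ N) {p q : Name} (hp : p.InList (N + 2))
    (hq : q.InList (N + 2)) (h : p.pat (N + 2) = q.pat (N + 2)) : p = q := by
  cases p <;> cases q <;>
    simp only [Name.InList, Name.pat, Pat.P1.injEq, Pat.P2.injEq, Pat.P3.injEq, Pat.P4.injEq,
      Pat.P5.injEq, reduceCtorEq, Name.T1.injEq, Name.T2.injEq, Name.T2'.injEq, Name.T3'.injEq,
      Name.T4.injEq, Name.T4'.injEq, Name.T4''.injEq, Name.T5.injEq, Name.T5'.injEq,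
      Name.T5''.injEq, true_and, and_true] at hp hq h ⊢ <;> omega

/-- In `P2`, `P4` and `P5` the case split asks whether the exponent forced by associativity lies
strictly below the range where powers stabilise. If so, it is determined; if not, only the few
largest exponents are possible, and they become the index `i`, `j` or `k` of the name. -/
theorem Pat.Valid.exists_name {N : ℕ} (hN : 5 ≤ N) {P : Pat} (hP : P.Valid N)
    (h : ∀ i j m, P = .P4 i j m → j ≤ i) : ∃ p : Name, p.InList (N + 2) ∧ p.pat (N + 2) = P := by
  cases P with
  | P1 m =>
    simp only [Pat.Valid] at hP
    refine ⟨.T1 (N + 2 - m), ?_, ?_⟩ <;> simp only [Name.InList, Name.pat, Pat.P1.injEq, true_and, and_true] <;> omega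
  | P2 j k =>
    simp only [Pat.Valid] at hP
    by_cases hk : 2 * k < N + 2
    · refine ⟨.T2 k, ?_, ?_⟩ <;> simp only [Name.InList, Name.pat, Pat.P2.injEq, true_and, and_true] <;> omega
    · refine ⟨.T2' (N + 2 - j) k, ?_, ?_⟩ <;> simp only [Name.InList, Name.pat, Pat.P2.injEq, true_and, and_true] <;>
        omega
  | P3 j k =>
    simp only [Pat.Valid] at hP
    by_cases hj : j = 2
    · refine ⟨.T3, trivial, ?_⟩
      simp only [Name.pat, Pat.P3.injEq]
      omega
    · refine ⟨.T3' (N + 2 - j), ?_, ?_⟩ <;> simp only [Name.InList, Name.pat, Pat.P3.injEq, true_and, and_true] <;>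
        omega
  | P4 i j m =>
    have hji := h i j m rfl
    simp only [Pat.Valid] at hP
    by_cases hi : 3 * i < N + 2
    · refine ⟨.T4 i, ?_, ?_⟩ <;> simp only [Name.InList, Name.pat, Pat.P4.injEq, true_and, and_true] <;> omega
    by_cases hi' : i + 2 ≤ N
    · refine ⟨.T4' (N + 2 - m) i, ?_, ?_⟩ <;> simp only [Name.InList, Name.pat, Pat.P4.injEq, true_and, and_true] <;>
        omega
    · refine ⟨.T4'' (N + 2 - i) (N + 2 - j) (N + 2 - m), ?_, ?_⟩ <;>
        simp only [Name.InList, Name.pat, Pat.P4.injEq, true_and, and_true] <;> omega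
  | P5 i j m =>
    simp only [Pat.Valid] at hP
    by_cases hi : 2 * i < N + 1
    · refine ⟨.T5 i, ?_, ?_⟩ <;> simp only [Name.InList, Name.pat, Pat.P5.injEq, true_and, and_true] <;> omega
    by_cases hi' : i + 3 ≤ N
    · refine ⟨.T5' (N + 2 - j) i, ?_, ?_⟩ <;> simp only [Name.InList, Name.pat, Pat.P5.injEq, true_and, and_true] <;>
        omega
    · refine ⟨.T5'' (N + 2 - i) (N + 2 - j) (N + 2 - m), ?_, ?_⟩ <;>
        simp only [Name.InList, Name.pat, Pat.P5.injEq, true_and, and_true] <;> omega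

theorem Name.rels_iff_sat {S : Type*} [Semigroup S] {N : ℕ} (p : Name) (f : Word →ₙ* S) :
    (∀ r ∈ insert (spow u (N + 2 - 2), spow u (N + 2 - 1)) (p.extraRels (N + 2)),
      f r.1 = f r.2) ↔ (p.pat (N + 2)).Sat N (f u) (f v) := by
  cases p <;>
    simp only [Name.extraRels, Name.pat, Pat.Sat, Pat.Rel, Set.forall_mem_insert,
      Set.mem_singleton_iff, forall_eq, map_spow, map_mul, spow_two, spow_three,
      Nat.add_sub_cancel, Nat.add_succ_sub_one] <;> try tauto
  -- `T4` and `T4'` list `uv = vu` and `uv = u^k`, whereas the shape records `uv = u^k` and `vu =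
  -- u^k`.
  all_goals
    refine and_congr_right fun _ => ⟨fun h => ⟨h.2.1, h.1 ▸ h.2.1, h.2.2⟩,
      fun h => ⟨h.1.trans h.2.1.symm, h.1, h.2.2⟩⟩

/-- The first generator of a semigroup of the list. -/
def Name.genU (n : ℕ) (p : Name) : T n p := Presented.mk _ u

/-- The second generator of a semigroup of the list. -/
def Name.genV (n : ℕ) (p : Name) : T n p := Presented.mk _ v

theorem Name.sat_gen (N : ℕ) (p : Name) :
    (p.pat (N + 2)).Sat N (p.genU (N + 2)) (p.genV (N + 2)) :=
  (p.rels_iff_sat _).1 fun _ hr => Presented.mk_eq hr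

theorem Name.closure_gen (n : ℕ) (p : Name) :
    Subsemigroup.closure {p.genU n, p.genV n} = ⊤ := by
  refine eq_top_iff.2 fun q _ => ?_
  obtain ⟨w, rfl⟩ := Presented.mk_surjective q
  have hof : ∀ i : Fin 2, Presented.mk _ (FreeSemigroup.of i) ∈
      Subsemigroup.closure {p.genU n, p.genV n} := by
    intro i
    apply Subsemigroup.subset_closure
    fin_cases i
    · exact Or.inl rfl
    · exact Or.inr rfl
  induction w using FreeSemigroup.recOnMul with
  | ih1 i => exact hof i
  | ih2 i w _ hw => rw [map_mul]; exact mul_mem (hof i) (hw trivial)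

theorem Name.exists_hom {S : Type*} [Semigroup S] {N : ℕ} {p : Name} {a b : S}
    (h : (p.pat (N + 2)).Sat N a b) :
    ∃ g : T (N + 2) p →ₙ* S, g (p.genU _) = a ∧ g (p.genV _) = b := by
  obtain ⟨g, hg⟩ := Presented.exists_lift (FreeSemigroup.lift ![a, b])
    ((p.rels_iff_sat (FreeSemigroup.lift ![a, b])).2 h)
  exact ⟨g, hg u, hg v⟩

/-! ### Multiplication tables -/

/-- Names for the elements: powers of `u`, the generator `v`, and the remaining product. -/
inductive State : Type
  | pow (a : ℕ)
  | V
  | X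

/-- The element with the given name. -/
def State.val {S : Type*} [Mul S] (a b x : S) : State → S
  | .pow k => spow a k
  | .V => b
  | .X => x

/-- Identify all powers beyond the `N`-th. -/
def State.cap (N : ℕ) : State → State
  | .pow k => .pow (min k N)
  | .V => .V
  | .X => .X

/-- A multiplication table for the right multiplications by the two generators: the products
`uv`, `vu`, `v²`, and the exponents of `u²v`, `xu`, `xv`. -/
structure Sig where
  uv : State
  vu : State
  vv : State
  uuv : ℕ
  xu : ℕ
  xv : ℕ

/-- A product of the generators is `x` or a power of `u` of exponent at least two. -/
def State.IsProd (N : ℕ) (c : State) : Prop := c = .X ∨ ∃ k, 2 ≤ k ∧ k ≤ N ∧ c = .pow k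

/-- The basic constraints on a multiplication table. -/
structure Sig.Good (N : ℕ) (σ : Sig) : Prop where
  uv : σ.uv.IsProd N
  vu : σ.vu.IsProd N
  vv : σ.vv.IsProd N
  uuv : 3 ≤ σ.uuv
  xu : 3 ≤ σ.xu
  xv : 3 ≤ σ.xv
  exists_X : σ.uv = .X ∨ σ.vu = .X ∨ σ.vv = .X

/-- The elements `a`, `b`, `x` multiply according to the table. -/
structure Rules {S : Type*} [Semigroup S] (N : ℕ) (a b x : S) (σ : Sig) : Prop where
  stab : spow a N = spow a (N + 1)
  uv : a * b = σ.uv.val a b x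
  vu : b * a = σ.vu.val a b x
  vv : b * b = σ.vv.val a b x
  uuv : a * a * b = spow a σ.uuv
  xu : x * a = spow a σ.xu
  xv : x * b = spow a σ.xv

/-- The multiplication table of a shape. -/
def Pat.sig : Pat → Sig
  | .P1 m => ⟨.X, .X, .X, m, m, m⟩
  | .P2 j k => ⟨.X, .X, .pow j, k, k, j + 1⟩
  | .P3 j k => ⟨.X, .pow j, .X, k, j + 1, k⟩
  | .P4 i j m => ⟨.pow i, .pow j, .X, i + 1, 2 * j - 1, m⟩
  | .P5 i j m => ⟨.pow i, .X, .pow j, i + 1, m, m + i - 2⟩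

/-- The product of the generators that is not a power of the first one. -/
def Pat.extra {S : Type*} [Mul S] (a b : S) : Pat → S
  | .P1 _ => a * b
  | .P2 _ _ => a * b
  | .P3 _ _ => a * b
  | .P4 _ _ _ => b * b
  | .P5 _ _ _ => b * a

theorem Pat.Valid.good {N : ℕ} (hN : 5 ≤ N) {P : Pat} (hP : P.Valid N) : P.sig.Good N := by
  have hX : State.X.IsProd N := Or.inl rfl
  have hpow : ∀ {k}, 2 ≤ k → k ≤ N → (State.pow k).IsProd N := fun h h' => Or.inr ⟨_, h, h', rfl⟩
  cases P <;> simp only [Pat.Valid] at hP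
  · exact ⟨hX, hX, hX, by dsimp only [Pat.sig]; omega, by dsimp only [Pat.sig]; omega,
      by dsimp only [Pat.sig]; omega, Or.inl rfl⟩
  · exact ⟨hX, hX, hpow (by omega) (by omega), by dsimp only [Pat.sig]; omega,
      by dsimp only [Pat.sig]; omega, by dsimp only [Pat.sig]; omega, Or.inl rfl⟩
  · exact ⟨hX, hpow (by omega) (by omega), hX, by dsimp only [Pat.sig]; omega,
      by dsimp only [Pat.sig]; omega, by dsimp only [Pat.sig]; omega, Or.inl rfl⟩
  · exact ⟨hpow (by omega) (by omega), hpow (by omega) (by omega), hX,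
      by dsimp only [Pat.sig]; omega, by dsimp only [Pat.sig]; omega,
      by dsimp only [Pat.sig]; omega, Or.inr (Or.inr rfl)⟩
  · exact ⟨hpow (by omega) (by omega), hX, hpow (by omega) (by omega),
      by dsimp only [Pat.sig]; omega, by dsimp only [Pat.sig]; omega,
      by dsimp only [Pat.sig]; omega, Or.inr (Or.inl rfl)⟩

section Semigroups

variable {S : Type*} [Semigroup S] {N : ℕ} {a b x : S}

theorem spow_mul_of_mul_mul {α : ℕ} (hα : 3 ≤ α) (h : a * a * b = spow a α) {k : ℕ} (hk : 2 ≤ k) :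
    spow a k * b = spow a (k + α - 2) := by
  obtain ⟨k, rfl⟩ := Nat.exists_eq_add_of_le' hk
  rcases Nat.eq_zero_or_pos k with rfl | hk'
  · rw [Nat.zero_add, spow_two, h, Nat.add_sub_cancel_left]
  · rw [spow_add a hk' (by omega), mul_assoc, spow_two, h, ← spow_add a hk' (by omega)]
    congr 1
    omega

theorem mul_spow_of_mul_mul {β : ℕ} (hβ : 3 ≤ β) (h : b * (a * a) = spow a β) {k : ℕ}
    (hk : 2 ≤ k) : b * spow a k = spow a (k + β - 2) := by
  obtain ⟨k, rfl⟩ := Nat.exists_eq_add_of_le' hk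
  rcases Nat.eq_zero_or_pos k with rfl | hk'
  · rw [Nat.zero_add, spow_two, h, Nat.add_sub_cancel_left]
  · rw [add_comm k, spow_add a (by omega) hk', ← mul_assoc, spow_two, h,
      ← spow_add a (by omega) hk']
    congr 1
    omega

theorem Rules.spow_mul {σ : Sig} (hσ : σ.Good N) (h : Rules N a b x σ) {k : ℕ} (hk : 2 ≤ k) :
    spow a k * b = spow a (k + σ.uuv - 2) :=
  spow_mul_of_mul_mul hσ.uuv h.uuv hk

/-- Each entry of the table follows from the relations by reassociating a word of length three and
moving `b` past powers of `a`. For instance, in `P4` one has b²a = b·a^j = a^(2j-1). -/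
theorem Pat.Sat.rules {P : Pat} (hN : 5 ≤ N) (hP : P.Valid N) (h : P.Sat N a b) :
    Rules N a b (P.extra a b) P.sig := by
  obtain ⟨hs, h⟩ := h
  cases P with
  | P1 m =>
    obtain ⟨h1, h2, h3⟩ := h
    have h4 : a * a * b = spow a m := by rw [← h3, mul_assoc, ← h2, ← mul_assoc, ← h2]
    exact ⟨hs, rfl, h1.symm, h2, h4, by
      change a * b * a = spow a m
      rw [mul_assoc, ← h1, ← mul_assoc, h4], by
      change a * b * b = spow a m
      rw [← h2, h3]⟩
  | P2 j k =>
    obtain ⟨h1, h2, h3⟩ := h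
    simp only [Pat.Valid] at hP
    exact ⟨hs, rfl, h1.symm, h2, h3, by
      change a * b * a = spow a k
      rw [mul_assoc, ← h1, ← mul_assoc, h3], by
      change a * b * b = spow a (j + 1)
      rw [mul_assoc, h2, spow_succ' _ (by omega)]⟩
  | P3 j k =>
    obtain ⟨h1, h2, h3⟩ := h
    simp only [Pat.Valid] at hP
    exact ⟨hs, rfl, h2, h1, by rw [mul_assoc, ← h1]; exact h3, by
      change a * b * a = spow a (j + 1)
      rw [mul_assoc, h2, spow_succ' _ (by omega)], by
      change a * b * b = spow a k
      rw [mul_assoc, h3]⟩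
  | P4 i j m =>
    obtain ⟨h1, h2, h3⟩ := h
    simp only [Pat.Valid] at hP
    have h4 : b * (a * a) = spow a (j + 1) := by
      rw [← mul_assoc, h2, spow_succ _ (by omega)]
    exact ⟨hs, h1, h2, rfl, by rw [mul_assoc, h1]; exact (spow_succ' _ (by omega)).symm, by
      change b * b * a = spow a (2 * j - 1)
      rw [mul_assoc, h2, mul_spow_of_mul_mul (by omega) h4 (by omega)]
      congr 1
      omega, h3⟩
  | P5 i j m =>
    obtain ⟨h1, h2, h3⟩ := h
    simp only [Pat.Valid] at hP
    exact ⟨hs, h1, rfl, h2, by rw [mul_assoc, h1]; exact (spow_succ' _ (by omega)).symm, by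
      change b * a * a = spow a m
      rw [mul_assoc, h3], by
      change b * a * b = spow a (m + i - 2)
      rw [mul_assoc, h1, mul_spow_of_mul_mul (by omega) h3 (by omega), add_comm m]⟩

end Semigroups

/-! ### The right action on formal names -/

section Action

/-- Right multiplication by `u`, where `pow 0` stands for an identity. -/
def Sig.actU (N : ℕ) (σ : Sig) : State → State
  | .pow a => .pow (min (a + 1) N)
  | .V => σ.vu.cap N
  | .X => .pow (min σ.xu N)

/-- Right multiplication by `v`, where `pow 0` stands for an identity. -/
def Sig.actV (N : ℕ) (σ : Sig) : State → State
  | .pow 0 => .V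
  | .pow 1 => σ.uv.cap N
  | .pow (a + 2) => .pow (min (a + σ.uuv) N)
  | .V => σ.vv.cap N
  | .X => .pow (min σ.xv N)

/-- Transformations of the set of names, composed from left to right. -/
abbrev Trans : Type := (Function.End State)ᵐᵒᵖ

/-- The transformation given by a function. -/
def toTrans (f : State → State) : Trans := MulOpposite.op f

theorem toTrans_mul (f g : State → State) : toTrans f * toTrans g = toTrans (g ∘ f) := rfl

theorem spow_toTrans (f : State → State) {k : ℕ} (hk : 1 ≤ k) :
    spow (toTrans f) k = toTrans f^[k] := by
  induction k, hk using Nat.le_induction with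
  | base => rfl
  | succ k hk ih => rw [spow_succ _ hk, ih, toTrans_mul, Function.iterate_succ']

variable {N : ℕ} {σ : Sig}

theorem Sig.actU_iterate_pow (a : ℕ) {k : ℕ} (hk : 1 ≤ k) :
    (σ.actU N)^[k] (.pow a) = .pow (min (a + k) N) := by
  induction k, hk using Nat.le_induction with
  | base => rfl
  | succ k hk ih =>
    rw [Function.iterate_succ_apply', ih]
    simp only [Sig.actU, State.pow.injEq]
    omega

theorem Sig.actU_iterate_X {k : ℕ} (hk : 1 ≤ k) :
    (σ.actU N)^[k] .X = .pow (min (σ.xu + k - 1) N) := by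
  obtain ⟨k, rfl⟩ := Nat.exists_eq_add_of_le' hk
  rw [Function.iterate_succ_apply]
  rcases Nat.eq_zero_or_pos k with rfl | hk'
  · rfl
  · rw [Sig.actU, Sig.actU_iterate_pow _ hk', State.pow.injEq]
    omega

theorem Sig.actU_iterate_V_of_pow {j : ℕ} (h : σ.vu = .pow j) {k : ℕ} (hk : 1 ≤ k) :
    (σ.actU N)^[k] .V = .pow (min (j + k - 1) N) := by
  obtain ⟨k, rfl⟩ := Nat.exists_eq_add_of_le' hk
  rw [Function.iterate_succ_apply, Sig.actU, h, State.cap]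
  rcases Nat.eq_zero_or_pos k with rfl | hk'
  · rfl
  · rw [Sig.actU_iterate_pow _ hk', State.pow.injEq]
    omega

theorem Sig.actU_iterate_V_of_X (h : σ.vu = .X) {k : ℕ} (hk : 2 ≤ k) :
    (σ.actU N)^[k] .V = .pow (min (σ.xu + k - 2) N) := by
  obtain ⟨k, rfl⟩ := Nat.exists_eq_add_of_le' (show 1 ≤ k by omega)
  rw [Function.iterate_succ_apply, Sig.actU, h, State.cap, Sig.actU_iterate_X (by omega),
    State.pow.injEq]
  omega

theorem Sig.actV_pow {a : ℕ} (ha : 2 ≤ a) :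
    σ.actV N (.pow a) = .pow (min (a + σ.uuv - 2) N) := by
  obtain ⟨a, rfl⟩ := Nat.exists_eq_add_of_le' ha
  simp only [Sig.actV, State.pow.injEq]
  omega

theorem State.ext_of_pow {f g : State → State} (h0 : f (.pow 0) = g (.pow 0))
    (h1 : f (.pow 1) = g (.pow 1)) (h2 : ∀ a, 2 ≤ a → f (.pow a) = g (.pow a))
    (hV : f .V = g .V) (hX : f .X = g .X) : f = g := by
  funext s
  match s with
  | .pow 0 => exact h0
  | .pow 1 => exact h1
  | .pow (a + 2) => exact h2 _ (by omega)
  | .V => exact hV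
  | .X => exact hX

end Action
section Equations

variable {N : ℕ} {σ : Sig}

theorem Sig.actU_pow (a : ℕ) : σ.actU N (.pow a) = .pow (min (a + 1) N) := rfl

theorem Sig.actU_V : σ.actU N .V = σ.vu.cap N := rfl

theorem Sig.actU_X : σ.actU N .X = .pow (min σ.xu N) := rfl

theorem Sig.actV_pow_zero {a : ℕ} (ha : a = 0) : σ.actV N (.pow a) = .V := by rw [ha]; rfl

theorem Sig.actV_pow_one {a : ℕ} (ha : a = 1) : σ.actV N (.pow a) = σ.uv.cap N := by rw [ha]; rfl

theorem Sig.actV_V : σ.actV N .V = σ.vv.cap N := rfl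

theorem Sig.actV_X : σ.actV N .X = .pow (min σ.xv N) := rfl

end Equations

theorem Sig.actU_stab {N : ℕ} {σ : Sig} (hN : 5 ≤ N) (hσ : σ.Good N) :
    spow (toTrans (σ.actU N)) N = spow (toTrans (σ.actU N)) (N + 1) := by
  rw [spow_toTrans _ (by omega), spow_toTrans _ (by omega)]
  have h3 := hσ.xu
  have hp : ∀ a, (σ.actU N)^[N] (.pow a) = (σ.actU N)^[N + 1] (.pow a) := by
    intro a
    rw [Sig.actU_iterate_pow _ (by omega), Sig.actU_iterate_pow _ (by omega), State.pow.injEq]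
    omega
  refine congrArg toTrans (State.ext_of_pow (hp _) (hp _) (fun a _ => hp a) ?_ ?_)
  · rcases hσ.vu with h | ⟨j, hj, -, h⟩
    · rw [Sig.actU_iterate_V_of_X h (by omega), Sig.actU_iterate_V_of_X h (by omega),
        State.pow.injEq]
      omega
    · rw [Sig.actU_iterate_V_of_pow h (by omega), Sig.actU_iterate_V_of_pow h (by omega),
        State.pow.injEq]
      omega
  · rw [Sig.actU_iterate_X (by omega), Sig.actU_iterate_X (by omega), State.pow.injEq]
    omega

/-- This is the consistency check for the table, repeated below for each shape. A relation is an
equality of two maps on states, compared on the identity, on `u`, on higher powers, on `v` and on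
`x`. What remains is an equality of exponents truncated at `N`, and this is where `Pat.Valid` is
needed. -/
theorem Pat.Valid.rel_trans_P1 {N m : ℕ} (hN : 5 ≤ N) (hP : (Pat.P1 m).Valid N) :
    (Pat.P1 m).Rel (toTrans ((Pat.P1 m).sig.actU N)) (toTrans ((Pat.P1 m).sig.actV N)) := by
  simp only [Pat.Valid] at hP
  refine ⟨?_, ?_, ?_⟩
  all_goals
    simp (disch := omega) only [toTrans_mul, spow_toTrans]
    refine congrArg toTrans (State.ext_of_pow ?_ ?_ (fun a ha => ?_) ?_ ?_)
  all_goals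
    simp (disch := omega) only [Function.comp_apply, Sig.actU_pow, Sig.actU_V, Sig.actU_X,
      Sig.actV_pow_zero, Sig.actV_pow_one, Sig.actV_V, Sig.actV_X, Sig.actV_pow,
      Sig.actU_iterate_pow, Sig.actU_iterate_X,
      Sig.actU_iterate_V_of_X (σ := (Pat.P1 m).sig) rfl]
    simp (disch := omega) only [Pat.sig, State.cap, Sig.actU_pow, Sig.actU_X, Sig.actV_X,
      Sig.actV_pow, State.pow.injEq]
  all_goals omega

theorem Pat.Valid.rel_trans_P2 {N j k : ℕ} (hN : 5 ≤ N) (hP : (Pat.P2 j k).Valid N) :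
    (Pat.P2 j k).Rel (toTrans ((Pat.P2 j k).sig.actU N)) (toTrans ((Pat.P2 j k).sig.actV N)) := by
  simp only [Pat.Valid] at hP
  refine ⟨?_, ?_, ?_⟩
  all_goals
    simp (disch := omega) only [toTrans_mul, spow_toTrans]
    refine congrArg toTrans (State.ext_of_pow ?_ ?_ (fun a ha => ?_) ?_ ?_)
  all_goals
    simp (disch := omega) only [Function.comp_apply, Sig.actU_pow, Sig.actU_V, Sig.actU_X,
      Sig.actV_pow_zero, Sig.actV_pow_one, Sig.actV_V, Sig.actV_X, Sig.actV_pow,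
      Sig.actU_iterate_pow, Sig.actU_iterate_X,
      Sig.actU_iterate_V_of_X (σ := (Pat.P2 j k).sig) rfl]
    simp (disch := omega) only [Pat.sig, State.cap, Sig.actU_pow, Sig.actU_X, Sig.actV_X,
      Sig.actV_pow, State.pow.injEq]
  all_goals omega

theorem Pat.Valid.rel_trans_P3 {N j k : ℕ} (hN : 5 ≤ N) (hP : (Pat.P3 j k).Valid N) :
    (Pat.P3 j k).Rel (toTrans ((Pat.P3 j k).sig.actU N)) (toTrans ((Pat.P3 j k).sig.actV N)) := by
  simp only [Pat.Valid] at hP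
  refine ⟨?_, ?_, ?_⟩
  all_goals
    simp (disch := omega) only [toTrans_mul, spow_toTrans]
    refine congrArg toTrans (State.ext_of_pow ?_ ?_ (fun a ha => ?_) ?_ ?_)
  all_goals
    simp (disch := omega) only [Function.comp_apply, Sig.actU_pow, Sig.actU_V, Sig.actU_X,
      Sig.actV_pow_zero, Sig.actV_pow_one, Sig.actV_V, Sig.actV_X, Sig.actV_pow,
      Sig.actU_iterate_pow, Sig.actU_iterate_X,
      Sig.actU_iterate_V_of_pow (σ := (Pat.P3 j k).sig) rfl]
    simp (disch := omega) only [Pat.sig, State.cap, Sig.actU_pow, Sig.actU_X, Sig.actV_X,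
      Sig.actV_pow, State.pow.injEq]
  all_goals omega

theorem Pat.Valid.rel_trans_P4 {N i j m : ℕ} (hN : 5 ≤ N) (hP : (Pat.P4 i j m).Valid N) :
    (Pat.P4 i j m).Rel (toTrans ((Pat.P4 i j m).sig.actU N)) (toTrans ((Pat.P4 i j m).sig.actV N)) := by
  simp only [Pat.Valid] at hP
  refine ⟨?_, ?_, ?_⟩
  all_goals
    simp (disch := omega) only [toTrans_mul, spow_toTrans]
    refine congrArg toTrans (State.ext_of_pow ?_ ?_ (fun a ha => ?_) ?_ ?_)
  all_goals
    simp (disch := omega) only [Function.comp_apply, Sig.actU_pow, Sig.actU_V, Sig.actU_X,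
      Sig.actV_pow_zero, Sig.actV_pow_one, Sig.actV_V, Sig.actV_X, Sig.actV_pow,
      Sig.actU_iterate_pow, Sig.actU_iterate_X,
      Sig.actU_iterate_V_of_pow (σ := (Pat.P4 i j m).sig) rfl]
    simp (disch := omega) only [Pat.sig, State.cap, Sig.actU_pow, Sig.actU_X, Sig.actV_X,
      Sig.actV_pow, State.pow.injEq]
  all_goals omega

theorem Pat.Valid.rel_trans_P5 {N i j m : ℕ} (hN : 5 ≤ N) (hP : (Pat.P5 i j m).Valid N) :
    (Pat.P5 i j m).Rel (toTrans ((Pat.P5 i j m).sig.actU N)) (toTrans ((Pat.P5 i j m).sig.actV N)) := by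
  simp only [Pat.Valid] at hP
  refine ⟨?_, ?_, ?_⟩
  all_goals
    simp (disch := omega) only [toTrans_mul, spow_toTrans]
    refine congrArg toTrans (State.ext_of_pow ?_ ?_ (fun a ha => ?_) ?_ ?_)
  all_goals
    simp (disch := omega) only [Function.comp_apply, Sig.actU_pow, Sig.actU_V, Sig.actU_X,
      Sig.actV_pow_zero, Sig.actV_pow_one, Sig.actV_V, Sig.actV_X, Sig.actV_pow,
      Sig.actU_iterate_pow, Sig.actU_iterate_X,
      Sig.actU_iterate_V_of_X (σ := (Pat.P5 i j m).sig) rfl]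
    simp (disch := omega) only [Pat.sig, State.cap, Sig.actU_pow, Sig.actU_X, Sig.actV_X,
      Sig.actV_pow, State.pow.injEq]
  all_goals omega

theorem Pat.Valid.sat_trans {N : ℕ} (hN : 5 ≤ N) {P : Pat} (hP : P.Valid N) :
    P.Sat N (toTrans (P.sig.actU N)) (toTrans (P.sig.actV N)) := by
  refine ⟨Sig.actU_stab hN (hP.good hN), ?_⟩
  cases P with
  | P1 m => exact hP.rel_trans_P1 hN
  | P2 j k => exact hP.rel_trans_P2 hN
  | P3 j k => exact hP.rel_trans_P3 hN
  | P4 i j m => exact hP.rel_trans_P4 hN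
  | P5 i j m => exact hP.rel_trans_P5 hN

/-! ### Models: order, class and generators -/

/-- `S` is generated by `a` and `b`, which multiply according to the table `σ`, and the powers
`a, …, a^N` and the elements `b`, `x` are pairwise distinct. -/
structure Model {S : Type*} [Semigroup S] (N : ℕ) (a b x : S) (σ : Sig) : Prop where
  good : σ.Good N
  rules : Rules N a b x σ
  gen : Subsemigroup.closure {a, b} = ⊤
  inj : ∀ i j, 1 ≤ i → i ≤ N → 1 ≤ j → j ≤ N → spow a i = spow a j → i = j
  spow_ne_b : ∀ i, 1 ≤ i → spow a i ≠ b
  spow_ne_x : ∀ i, 1 ≤ i → spow a i ≠ x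
  b_ne_x : b ≠ x

/-- Applying the transformation of an element to the adjoined identity `pow 0` returns the formal
name of that element, so elements with different names are different. -/
theorem Name.model {N : ℕ} (hN : 5 ≤ N) {p : Name} (hP : (p.pat (N + 2)).Valid N) :
    Model N (p.genU (N + 2)) (p.genV (N + 2))
      ((p.pat (N + 2)).extra (p.genU (N + 2)) (p.genV (N + 2))) (p.pat (N + 2)).sig := by
  obtain ⟨g, hu, hv⟩ := p.exists_hom (hP.sat_trans hN)
  have hcode : ∀ k, 1 ≤ k → (g (spow (p.genU (N + 2)) k)).unop (.pow 0) = .pow (min k N) := by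
    intro k hk
    rw [map_spow, hu, spow_toTrans _ hk]
    change (Sig.actU N _)^[k] _ = _
    rw [Sig.actU_iterate_pow _ hk, Nat.zero_add]
  have hb : (g (p.genV (N + 2))).unop (.pow 0) = .V := by rw [hv]; rfl
  have h1 : ∀ σ : Sig, σ.actU N (.pow 0) = .pow 1 := fun σ => by
    rw [Sig.actU_pow, State.pow.injEq]; omega
  have hx : (g ((p.pat (N + 2)).extra (p.genU (N + 2)) (p.genV (N + 2)))).unop (.pow 0) = .X := by
    cases hp : p.pat (N + 2) <;> rw [hp] at hu hv <;> rw [Pat.extra, map_mul] <;>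
      simp only [hu, hv, toTrans_mul]
    · change Sig.actV N _ (Sig.actU N _ (.pow 0)) = _; rw [h1]; rfl
    · change Sig.actV N _ (Sig.actU N _ (.pow 0)) = _; rw [h1]; rfl
    · change Sig.actV N _ (Sig.actU N _ (.pow 0)) = _; rw [h1]; rfl
    · rfl
    · rfl
  refine ⟨hP.good hN, (p.sat_gen N).rules hN hP, p.closure_gen _, ?_, ?_, ?_, ?_⟩
  · intro i j hi hi' hj hj' h
    have := congrArg (fun t => (g t).unop (State.pow 0)) h
    simp only [hcode i hi, hcode j hj, State.pow.injEq] at this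
    omega
  · intro i hi h
    have := congrArg (fun t => (g t).unop (State.pow 0)) h
    simp only [hcode i hi, hb, reduceCtorEq] at this
  · intro i hi h
    have := congrArg (fun t => (g t).unop (State.pow 0)) h
    simp only [hcode i hi, hx, reduceCtorEq] at this
  · intro h
    have := congrArg (fun t => (g t).unop (State.pow 0)) h
    simp only [hb, hx, reduceCtorEq] at this

section PowSucc

variable {S : Type*} [Semigroup S]

theorem mem_powSucc_succ {k : ℕ} {s : S} :
    s ∈ powSucc S (k + 1) ↔ ∃ y ∈ powSucc S k, ∃ t, y * t = s := by
  simp [powSucc, Set.mem_mul]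

theorem powSucc_succ_subset (k : ℕ) : powSucc S (k + 1) ⊆ powSucc S k := by
  induction k with
  | zero => exact Set.subset_univ _
  | succ k ih =>
    intro s hs
    obtain ⟨y, hy, t, rfl⟩ := mem_powSucc_succ.1 hs
    exact mem_powSucc_succ.2 ⟨y, ih hy, t, rfl⟩

theorem powSucc_antitone : Antitone (powSucc S) := antitone_nat_of_succ_le powSucc_succ_subset

theorem spow_mem_powSucc (a : S) (k : ℕ) : spow a (k + 1) ∈ powSucc S k := by
  induction k with
  | zero => exact Set.mem_univ _
  | succ k ih => exact mem_powSucc_succ.2 ⟨_, ih, a, (spow_succ a (by omega)).symm⟩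

/-- Indecomposable elements lie in every generating set. This gives minimality of the generators in
the models and, later, bounds the number of indecomposables. -/
theorem mem_of_closure_eq_top {B : Set S} (hB : Subsemigroup.closure B = ⊤) {c : S}
    (hc : ∀ s t : S, s * t ≠ c) : c ∈ B := by
  have h : ∀ s ∈ Subsemigroup.closure B, s = c → c ∈ B := by
    intro s hs
    induction hs using Subsemigroup.closure_induction with
    | mem s hs => exact fun h => h ▸ hs
    | mul s t _ _ _ _ => exact fun h => absurd h (hc s t)
  exact h c (hB ▸ Subsemigroup.mem_top c) rfl

end PowSucc

section Levels

variable {S : Type*} [Semigroup S] {N : ℕ} {a b x : S} {σ : Sig}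

/-- The elements of `S^(k+1)`, in terms of the generators. -/
def Level (a b x : S) (k : ℕ) (s : S) : Prop :=
  (∃ j, k + 1 ≤ j ∧ s = spow a j) ∨ (k ≤ 1 ∧ s = x) ∨ (k = 0 ∧ s = b)

theorem Level.of_succ {k : ℕ} {s : S} (h : Level a b x (k + 1) s) : Level a b x k s := by
  rcases h with ⟨j, hj, rfl⟩ | ⟨hk, rfl⟩ | ⟨hk, rfl⟩
  · exact Or.inl ⟨j, by omega, rfl⟩
  · exact Or.inr (Or.inl ⟨by omega, rfl⟩)
  · omega

theorem State.IsProd.level {c : State} (hc : c.IsProd N) : Level a b x 1 (c.val a b x) := by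
  rcases hc with rfl | ⟨k, hk, -, rfl⟩
  · exact Or.inr (Or.inl ⟨le_rfl, rfl⟩)
  · exact Or.inl ⟨k, hk, rfl⟩

/-- Every entry of a good table has at least the length of the word it replaces, with `x` counting
as length two. So a right factor never lowers the level, and one generator raises it. -/
theorem Model.level_mul (h : Model N a b x σ) {k : ℕ} {s : S} (hs : Level a b x k s) (t : S) :
    Level a b x (k + 1) (s * t) := by
  have ht : t ∈ Subsemigroup.closure {a, b} := h.gen ▸ Subsemigroup.mem_top t
  have hxu := h.good.xu
  have hxv := h.good.xv
  have huuv := h.good.uuv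
  induction ht using Subsemigroup.closure_induction generalizing s with
  | mem t ht =>
    rcases ht with rfl | rfl
    · rcases hs with ⟨j, hj, rfl⟩ | ⟨hk, rfl⟩ | ⟨rfl, rfl⟩
      · exact Or.inl ⟨j + 1, by omega, (spow_succ _ (by omega)).symm⟩
      · exact Or.inl ⟨_, by omega, h.rules.xu⟩
      · rw [h.rules.vu]
        exact h.good.vu.level
    · rcases hs with ⟨j, hj, rfl⟩ | ⟨hk, rfl⟩ | ⟨rfl, rfl⟩
      · rcases Nat.lt_or_ge j 2 with hj' | hj'
        · obtain ⟨rfl, rfl⟩ : j = 1 ∧ k = 0 := by omega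
          rw [spow_one, h.rules.uv]
          exact h.good.uv.level
        · exact Or.inl ⟨_, by omega, h.rules.spow_mul h.good hj'⟩
      · exact Or.inl ⟨_, by omega, h.rules.xv⟩
      · rw [h.rules.vv]
        exact h.good.vv.level
  | mul t₁ t₂ _ _ ih₁ ih₂ =>
    rw [← mul_assoc]
    exact ih₂ (ih₁ hs).of_succ

theorem Model.level_zero (h : Model N a b x σ) (s : S) : Level a b x 0 s := by
  have hs : s ∈ Subsemigroup.closure {a, b} := h.gen ▸ Subsemigroup.mem_top s
  induction hs using Subsemigroup.closure_induction with
  | mem s hs =>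
    rcases hs with rfl | rfl
    · exact Or.inl ⟨1, le_rfl, rfl⟩
    · exact Or.inr (Or.inr ⟨rfl, rfl⟩)
  | mul s t _ _ hs _ => exact (h.level_mul hs t).of_succ

theorem Model.level_of_mem_powSucc (h : Model N a b x σ) {k : ℕ} {s : S} (hs : s ∈ powSucc S k) :
    Level a b x k s := by
  induction k generalizing s with
  | zero => exact h.level_zero s
  | succ k ih =>
    obtain ⟨y, hy, t, rfl⟩ := mem_powSucc_succ.1 hs
    exact h.level_mul (ih hy) t

theorem Model.spow_eq (hN : 5 ≤ N) (h : Model N a b x σ) {k : ℕ} (hk : N ≤ k) :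
    spow a k = spow a N :=
  spow_eq_of_le (by omega) h.rules.stab hk

theorem Model.spow_inj (hN : 5 ≤ N) (h : Model N a b x σ) {i j : ℕ} (hi : 1 ≤ i) (hj : 1 ≤ j)
    (hij : spow a i = spow a j) : i = j ∨ N ≤ i ∧ N ≤ j := by
  rw [← spow_min (show 1 ≤ N by omega) h.rules.stab i,
    ← spow_min (show 1 ≤ N by omega) h.rules.stab j] at hij
  have := h.inj _ _ (by omega) (by omega) (by omega) (by omega) hij
  omega

theorem Model.mul_ne_left (hN : 5 ≤ N) (h : Model N a b x σ) (s t : S) : s * t ≠ a := by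
  intro hst
  rcases h.level_mul (h.level_zero s) t with ⟨j, hj, hj'⟩ | ⟨-, hx⟩ | ⟨h0, -⟩
  · have := h.spow_inj hN le_rfl (by omega) (show spow a 1 = spow a j from hst ▸ hj')
    omega
  · exact h.spow_ne_x 1 le_rfl (hst ▸ hx)
  · omega

theorem Model.mul_ne_right (h : Model N a b x σ) (s t : S) : s * t ≠ b := by
  intro hst
  rcases h.level_mul (h.level_zero s) t with ⟨j, hj, hj'⟩ | ⟨-, hx⟩ | ⟨h0, -⟩
  · exact h.spow_ne_b j (by omega) (hj' ▸ hst)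
  · exact h.b_ne_x (hst ▸ hx)
  · omega

theorem Model.exists_mul_eq_x (h : Model N a b x σ) : ∃ s t : S, s * t = x := by
  rcases h.good.exists_X with hX | hX | hX
  · exact ⟨a, b, by rw [h.rules.uv, hX]; rfl⟩
  · exact ⟨b, a, by rw [h.rules.vu, hX]; rfl⟩
  · exact ⟨b, b, by rw [h.rules.vv, hX]; rfl⟩

theorem Model.eq_or_eq_of_not_mul (h : Model N a b x σ) {c : S} (hc : ∀ s t : S, s * t ≠ c) :
    c = a ∨ c = b := by
  rcases h.level_zero c with ⟨j, hj, rfl⟩ | ⟨-, rfl⟩ | ⟨-, rfl⟩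
  · rcases Nat.lt_or_ge 1 j with hj' | hj'
    · obtain ⟨j, rfl⟩ := Nat.exists_eq_add_of_le' hj
      exact absurd (spow_succ a (by omega)).symm (hc _ _)
    · obtain rfl : j = 1 := by omega
      exact Or.inl rfl
  · obtain ⟨s, t, hst⟩ := h.exists_mul_eq_x
    exact absurd hst (hc s t)
  · exact Or.inr rfl

theorem Model.univ_eq (hN : 5 ≤ N) (h : Model N a b x σ) :
    (Set.univ : Set S) = insert b (insert x (spow a '' Set.Icc 1 N)) := by
  refine (Set.eq_univ_of_forall fun s => ?_).symm
  rcases h.level_zero s with ⟨j, hj, rfl⟩ | ⟨-, rfl⟩ | ⟨-, rfl⟩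
  · refine Or.inr (Or.inr ⟨min j N, ⟨by omega, by omega⟩, ?_⟩)
    exact spow_min (by omega) h.rules.stab j
  · exact Or.inr (Or.inl rfl)
  · exact Or.inl rfl

theorem Model.finite (hN : 5 ≤ N) (h : Model N a b x σ) : Finite S := by
  rw [← Set.finite_univ_iff, h.univ_eq hN]
  exact (((Set.finite_Icc 1 N).image _).insert _).insert _

theorem Model.card (hN : 5 ≤ N) (h : Model N a b x σ) : Nat.card S = N + 2 := by
  have hf : (spow a '' Set.Icc 1 N).Finite := (Set.finite_Icc 1 N).image _
  have hinj : Set.InjOn (spow a) (Set.Icc 1 N) := fun i hi j hj hij =>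
    h.inj i j hi.1 hi.2 hj.1 hj.2 hij
  rw [← Set.ncard_univ, h.univ_eq hN, Set.ncard_insert_of_notMem _ (hf.insert _),
    Set.ncard_insert_of_notMem _ hf, hinj.ncard_image, Set.ncard_eq_toFinset_card']
  · simp
  · rintro ⟨i, hi, hix⟩
    exact h.spow_ne_x i hi.1 hix
  · rintro (hbx | ⟨i, hi, hib⟩)
    · exact h.b_ne_x hbx
    · exact h.spow_ne_b i hi.1 hib

theorem Model.ncard_powSucc_eq_one (hN : 5 ≤ N) (h : Model N a b x σ) :
    (powSucc S (N - 1)).ncard = 1 := by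
  refine Set.ncard_eq_one.2 ⟨spow a N, Set.eq_singleton_iff_unique_mem.2 ⟨?_, fun s hs => ?_⟩⟩
  · have := spow_mem_powSucc a (N - 1)
    rwa [Nat.sub_add_cancel (by omega)] at this
  · rcases h.level_of_mem_powSucc hs with ⟨j, hj, rfl⟩ | ⟨hk, rfl⟩ | ⟨hk, rfl⟩
    · exact h.spow_eq hN (by omega)
    · omega
    · omega

theorem Model.nilpotencyClass_eq (hN : 5 ≤ N) (h : Model N a b x σ) :
    nilpotencyClass S = N - 1 := by
  refine le_antisymm (Nat.sInf_le (h.ncard_powSucc_eq_one hN))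
    (le_csInf ⟨_, h.ncard_powSucc_eq_one hN⟩ fun c hc => ?_)
  by_contra hlt
  obtain ⟨s, hs⟩ := Set.ncard_eq_one.1 hc
  -- Below class `N - 1`, the powers a^(c+1) and a^(c+2) are two distinct elements of S^(c+1).
  have h1 : spow a (c + 1) ∈ powSucc S c := spow_mem_powSucc a c
  have h2 : spow a (c + 1 + 1) ∈ powSucc S c :=
    powSucc_succ_subset c (spow_mem_powSucc a (c + 1))
  rw [hs] at h1 h2
  have := h.inj _ _ (by omega) (by omega) (by omega) (by omega) (Eq.trans h1 h2.symm)
  omega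

theorem Model.isCoclassTwoTwoGenerated (hN : 5 ≤ N) (h : Model N a b x σ) :
    IsCoclassTwoTwoGenerated (N + 2) S := by
  refine ⟨h.card hN, ⟨h.finite hN, ⟨_, h.ncard_powSucc_eq_one hN⟩, ?_⟩, {a, b}, ⟨h.gen, ?_⟩,
    Set.ncard_pair (h.spow_ne_b 1 le_rfl)⟩
  · rw [h.card hN, h.nilpotencyClass_eq hN]
    omega
  · rintro B hB - c (rfl | rfl)
    · exact mem_of_closure_eq_top hB (h.mul_ne_left hN)
    · exact mem_of_closure_eq_top hB h.mul_ne_right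

end Levels
-- (Anti-)isomorphisms between models
/-- `f` is a homomorphism or an anti-homomorphism. -/
def IsHomOrAntiHom {S S' : Type*} [Mul S] [Mul S'] (f : S → S') : Prop :=
  (∀ s t, f (s * t) = f s * f t) ∨ (∀ s t, f (s * t) = f t * f s)

section Maps

variable {S S' : Type*} [Semigroup S] [Semigroup S']

theorem IsoOrAntiIso.exists_equiv (h : IsoOrAntiIso S S') :
    ∃ f : S ≃ S', IsHomOrAntiHom f := by
  rcases id h with h | h <;> obtain ⟨f⟩ := h
  · exact ⟨f.toEquiv, Or.inl f.map_mul⟩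
  · exact ⟨f.toEquiv.trans MulOpposite.opEquiv.symm,
      Or.inr fun s t => congrArg MulOpposite.unop (f.map_mul s t)⟩

theorem IsHomOrAntiHom.map_spow {f : S → S'} (hf : IsHomOrAntiHom f) (s : S) (k : ℕ) :
    f (spow s k) = spow (f s) k := by
  rcases Nat.eq_zero_or_pos k with rfl | hk
  · rfl
  induction k, hk using Nat.le_induction with
  | base => rfl
  | succ k hk ih =>
    rcases hf with hf | hf
    · rw [spow_succ _ hk, hf, ih, spow_succ _ hk]
    · rw [spow_succ _ hk, hf, ih, spow_succ' _ hk]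

theorem IsHomOrAntiHom.map_mul_self {f : S → S'} (hf : IsHomOrAntiHom f) (s : S) :
    f (s * s) = f s * f s := by
  rcases hf with hf | hf <;> exact hf s s

theorem IsHomOrAntiHom.symm {f : S ≃ S'} (hf : IsHomOrAntiHom f) : IsHomOrAntiHom f.symm := by
  rcases hf with hf | hf
  · exact Or.inl fun s t => f.injective (by simp [hf])
  · exact Or.inr fun s t => f.injective (by simp [hf])

theorem mul_comm_of_closure_pair {a b : S} (h : Subsemigroup.closure {a, b} = ⊤)
    (hab : a * b = b * a) (s t : S) : s * t = t * s := by
  have h1 : ∀ c : S, c * a = a * c → c * b = b * c → ∀ r : S, c * r = r * c := by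
    intro c ha hb r
    have hr : r ∈ Subsemigroup.closure {a, b} := h ▸ Subsemigroup.mem_top r
    induction hr using Subsemigroup.closure_induction with
    | mem r hr => rcases hr with rfl | rfl <;> assumption
    | mul r r' _ _ ih ih' => rw [← mul_assoc, ih, mul_assoc, ih', mul_assoc]
  exact h1 s (h1 a rfl hab s).symm (h1 b hab.symm rfl s).symm t

end Maps

section Models

variable {S S' : Type*} [Semigroup S] [Semigroup S'] {N : ℕ} {a b x : S} {a' b' x' : S'}
  {σ σ' : Sig}

theorem Model.val_inj (h : Model N a b x σ) {c c' : State} (hc : c.IsProd N) (hc' : c'.IsProd N)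
    (heq : c.val a b x = c'.val a b x) : c = c' := by
  rcases hc with rfl | ⟨k, hk, hkN, rfl⟩ <;> rcases hc' with rfl | ⟨k', hk', hkN', rfl⟩
  · rfl
  · exact absurd heq.symm (h.spow_ne_x _ (by omega))
  · exact absurd heq (h.spow_ne_x _ (by omega))
  · rw [h.inj _ _ (by omega) hkN (by omega) hkN' heq]

theorem Model.mul_comm_iff (h : Model N a b x σ) : a * b = b * a ↔ σ.uv = σ.vu := by
  rw [h.rules.uv, h.rules.vu]
  exact ⟨h.val_inj h.good.uv h.good.vu, fun h => h ▸ rfl⟩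

theorem Model.mul_self_iff (hN : 5 ≤ N) (h : Model N a b x σ) :
    b * b = a * a ↔ σ.vv = .pow 2 := by
  rw [h.rules.vv, ← spow_two]
  exact ⟨h.val_inj h.good.vv (Or.inr ⟨2, le_rfl, by omega, rfl⟩), fun h => h ▸ rfl⟩

/-- Being indecomposable is preserved by (anti-)isomorphisms, and only the two generators are
indecomposable. -/
theorem Model.map_gen (hN : 5 ≤ N) (h : Model N a b x σ) (h' : Model N a' b' x' σ')
    {f : S ≃ S'} (hf : IsHomOrAntiHom f) : f a = a' ∧ f b = b' ∨ f a = b' ∧ f b = a' := by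
  have key : ∀ c : S, (∀ s t : S, s * t ≠ c) → f c = a' ∨ f c = b' := by
    intro c hc
    refine h'.eq_or_eq_of_not_mul fun s t hst => ?_
    rcases hf.symm with hg | hg
    · exact hc _ _ (by rw [← hg, hst, f.symm_apply_apply])
    · exact hc _ _ (by rw [← hg, hst, f.symm_apply_apply])
  have hab : f a ≠ f b := fun hab => h.spow_ne_b 1 le_rfl (f.injective hab)
  rcases key a (h.mul_ne_left hN) with ha | ha <;> rcases key b h.mul_ne_right with hb | hb
  · exact absurd (ha.trans hb.symm) hab
  · exact Or.inl ⟨ha, hb⟩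
  · exact Or.inr ⟨ha, hb⟩
  · exact absurd (ha.trans hb.symm) hab

/-- Apart from `b`, the element `x` is the only one that is not a power of `a`, so it must follow
the generators. -/
theorem Model.map_x (h : Model N a b x σ) (h' : Model N a' b' x' σ') {f : S ≃ S'}
    (hf : IsHomOrAntiHom f) (ha : f a = a') (hb : f b = b') : f x = x' := by
  rcases h'.level_zero (f x) with ⟨j, hj, hx⟩ | ⟨-, hx⟩ | ⟨-, hx⟩
  · rw [← ha, ← hf.map_spow] at hx
    exact absurd (f.injective hx).symm (h.spow_ne_x j (by omega))
  · exact hx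
  · exact absurd (f.injective (hx.trans hb.symm)).symm h.b_ne_x

theorem Model.map_val (h : Model N a b x σ) (h' : Model N a' b' x' σ') {f : S ≃ S'}
    (hf : IsHomOrAntiHom f) (ha : f a = a') (hb : f b = b') (c : State) :
    f (c.val a b x) = c.val a' b' x' := by
  cases c with
  | pow k => exact (hf.map_spow a k).trans (by rw [ha]; rfl)
  | V => exact hb
  | X => exact h.map_x h' hf ha hb

theorem Model.sig_eq_of_hom (hN : 5 ≤ N) (h : Model N a b x σ) (h' : Model N a' b' x' σ')
    {f : S ≃ S'} (hf : ∀ s t, f (s * t) = f s * f t) (ha : f a = a') (hb : f b = b') :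
    σ.uv = σ'.uv ∧ σ.vu = σ'.vu ∧ σ.vv = σ'.vv ∧ (σ.uuv = σ'.uuv ∨ N ≤ σ.uuv ∧ N ≤ σ'.uuv) ∧
      (σ.xu = σ'.xu ∨ N ≤ σ.xu ∧ N ≤ σ'.xu) ∧ (σ.xv = σ'.xv ∨ N ≤ σ.xv ∧ N ≤ σ'.xv) := by
  have hv := h.map_val h' (Or.inl hf) ha hb
  have hx := h.map_x h' (Or.inl hf) ha hb
  have hp : ∀ k, f (spow a k) = spow a' k := fun k => hv (.pow k)
  have g := h.good
  have g' := h'.good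
  have g1 := g.uuv
  have g2 := g.xu
  have g3 := g.xv
  have g1' := g'.uuv
  have g2' := g'.xu
  have g3' := g'.xv
  refine ⟨h'.val_inj g.uv g'.uv ?_, h'.val_inj g.vu g'.vu ?_, h'.val_inj g.vv g'.vv ?_,
    h'.spow_inj hN (by omega) (by omega) ?_, h'.spow_inj hN (by omega) (by omega) ?_,
    h'.spow_inj hN (by omega) (by omega) ?_⟩
  · rw [← hv, ← h.rules.uv, hf, ha, hb, h'.rules.uv]
  · rw [← hv, ← h.rules.vu, hf, ha, hb, h'.rules.vu]
  · rw [← hv, ← h.rules.vv, hf, hb, h'.rules.vv]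
  · rw [← hp, ← h.rules.uuv, hf, hf, ha, hb, h'.rules.uuv]
  · rw [← hp, ← h.rules.xu, hf, ha, hx, h'.rules.xu]
  · rw [← hp, ← h.rules.xv, hf, hb, hx, h'.rules.xv]

theorem Model.sig_eq_of_antiHom (h : Model N a b x σ) (h' : Model N a' b' x' σ')
    {f : S ≃ S'} (hf : ∀ s t, f (s * t) = f t * f s) (ha : f a = a') (hb : f b = b') :
    σ.uv = σ'.vu ∧ σ.vu = σ'.uv ∧ σ.vv = σ'.vv := by
  have hv := h.map_val h' (Or.inr hf) ha hb
  refine ⟨h'.val_inj h.good.uv h'.good.vu ?_, h'.val_inj h.good.vu h'.good.uv ?_,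
    h'.val_inj h.good.vv h'.good.vv ?_⟩
  · rw [← hv, ← h.rules.uv, hf, ha, hb, h'.rules.vu]
  · rw [← hv, ← h.rules.vu, hf, ha, hb, h'.rules.uv]
  · rw [← hv, ← h.rules.vv, hf, hb, h'.rules.vv]

variable {P Q : Pat}

theorem Model.pat_eq_of_hom (hN : 5 ≤ N) (hP : P.Valid N) (hQ : Q.Valid N)
    (h : Model N a b x P.sig) (h' : Model N a' b' x' Q.sig)
    {f : S ≃ S'} (hf : ∀ s t, f (s * t) = f s * f t) (ha : f a = a') (hb : f b = b') :
    P = Q := by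
  have := h.sig_eq_of_hom hN h' hf ha hb
  cases P <;> cases Q <;>
    simp only [Pat.sig, Pat.Valid, reduceCtorEq, false_and, and_false, true_and,
      State.pow.injEq, Pat.P1.injEq, Pat.P2.injEq, Pat.P3.injEq, Pat.P4.injEq,
      Pat.P5.injEq] at this hP hQ ⊢ <;> omega

/-- In the commutative case an anti-homomorphism is a homomorphism. Otherwise the positions of `x`
among uv, vu, v² must match after exchanging uv and vu, which rules out `P3` and `P5`. -/
theorem Model.pat_eq_of_antiHom (hN : 5 ≤ N) (hP : P.Valid N) (hQ : Q.Valid N)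
    (h : Model N a b x P.sig) (h' : Model N a' b' x' Q.sig)
    {f : S ≃ S'} (hf : ∀ s t, f (s * t) = f t * f s) (ha : f a = a') (hb : f b = b') :
    P = Q ∨ ∃ i j m m', i ≠ j ∧ P = .P4 i j m ∧ Q = .P4 j i m' := by
  obtain ⟨h1, h2, h3⟩ := h.sig_eq_of_antiHom h' hf ha hb
  by_cases hc : P.sig.uv = P.sig.vu
  · have hcomm := mul_comm_of_closure_pair h'.gen (h'.mul_comm_iff.2 (by rw [← h2, ← hc, h1]))
    exact Or.inl (h.pat_eq_of_hom hN hP hQ h' (fun s t => by rw [hf, hcomm]) ha hb)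
  · right
    cases P <;> cases Q <;> simp only [Pat.sig, reduceCtorEq, not_true] at h1 h2 h3 hc
    case P4.P4 i j m i' j' m' =>
      rw [State.pow.injEq] at h1 h2 hc
      subst h1 h2
      exact ⟨i, j, m, m', hc, rfl, rfl⟩

/-- The shapes for which the two generators play similar roles. -/
def Pat.IsSymm (P : Pat) : Prop := P = .P2 2 3 ∨ P = .P3 2 3 ∨ P = .P4 2 2 3 ∨ P = .P5 2 2 3

theorem Pat.Valid.isSymm_or (hN : 5 ≤ N) (hP : P.Valid N) :
    P.IsSymm ∨ (P.sig.vv = .X ∧ 4 ≤ P.sig.xv) ∨ ∃ j, 3 ≤ j ∧ P.sig.vv = .pow j := by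
  cases P <;>
    simp only [Pat.IsSymm, Pat.sig, Pat.Valid, reduceCtorEq, false_and, false_or, or_false,
      true_and, State.pow.injEq, Pat.P2.injEq, Pat.P3.injEq, Pat.P4.injEq, Pat.P5.injEq,
      exists_eq_right', exists_false, and_false] at hP ⊢ <;> omega

/-- Outside the symmetric shapes b³ is already a^j with j ≥ 4. Then b^k is a power of `a` of
exponent above k for all k ≥ 3, so b^(N-1) is the stable power a^N, and so is b^N. -/
theorem Model.isSymm (hN : 5 ≤ N) (hP : P.Valid N) (h : Model N a b x P.sig)
    (hb : spow b (N - 1) ≠ spow b N) : P.IsSymm := by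
  refine (hP.isSymm_or hN).resolve_right fun hvv => hb ?_
  have huuv := h.good.uuv
  have h3 : ∀ k, 3 ≤ k → ∃ j, k + 1 ≤ j ∧ spow b k = spow a j := by
    intro k hk
    induction k, hk using Nat.le_induction with
    | base =>
      rw [spow_three, h.rules.vv]
      rcases hvv with ⟨h1, h2⟩ | ⟨j, hj, h1⟩
      · exact ⟨_, h2, by rw [h1]; exact h.rules.xv⟩
      · exact ⟨j + P.sig.uuv - 2, by omega, by
          rw [h1]; exact h.rules.spow_mul h.good (by omega)⟩
    | succ k hk ih =>
      obtain ⟨j, hj, hbj⟩ := ih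
      exact ⟨j + P.sig.uuv - 2, by omega, by
        rw [spow_succ _ (by omega), hbj, h.rules.spow_mul h.good (by omega)]⟩
  obtain ⟨i, hi, hi'⟩ := h3 (N - 1) (by omega)
  obtain ⟨j, hj, hj'⟩ := h3 N (by omega)
  rw [hi', hj', h.spow_eq hN (by omega), h.spow_eq hN (show N ≤ j by omega)]

theorem Model.isSymm_of_swap (hN : 5 ≤ N) (hP : P.Valid N) (h : Model N a b x P.sig)
    (h' : Model N a' b' x' σ') {f : S ≃ S'} (hf : IsHomOrAntiHom f) (hb : f b = a') :
    P.IsSymm := by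
  refine h.isSymm hN hP fun heq => ?_
  have := congrArg f heq
  rw [hf.map_spow, hf.map_spow, hb] at this
  have := h'.inj _ _ (by omega) (by omega) (by omega) (by omega) this
  omega

/-- The conditions ab = ba and b² = a² are unaffected by exchanging the generators or reversing
products, and together they separate the four symmetric shapes. -/
theorem Model.pat_eq_of_swap (hN : 5 ≤ N) (hP : P.Valid N) (hQ : Q.Valid N)
    (h : Model N a b x P.sig) (h' : Model N a' b' x' Q.sig)
    {f : S ≃ S'} (hf : IsHomOrAntiHom f) (ha : f a = b') (hb : f b = a') : P = Q := by
  have h1 := h.isSymm_of_swap hN hP h' hf hb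
  have h2 := h'.isSymm_of_swap hN hQ h hf.symm (f.symm_apply_eq.2 ha.symm)
  have h3 : a * b = b * a ↔ a' * b' = b' * a' := by
    rw [← f.injective.eq_iff]
    rcases hf with hf | hf <;> rw [hf, hf, ha, hb]
    exact eq_comm
  have h4 : b * b = a * a ↔ b' * b' = a' * a' := by
    rw [← f.injective.eq_iff, hf.map_mul_self, hf.map_mul_self, ha, hb]
    exact eq_comm
  rw [h.mul_comm_iff, h'.mul_comm_iff] at h3
  rw [h.mul_self_iff hN, h'.mul_self_iff hN] at h4
  rcases h1 with rfl | rfl | rfl | rfl <;> rcases h2 with rfl | rfl | rfl | rfl <;>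
    simp [Pat.sig] at h3 h4 ⊢

end Models

/-! ### Irredundance and self-duality -/

theorem Name.eq_of_isoOrAntiIso {N : ℕ} (hN : 5 ≤ N) {p q : Name} (hp : p.InList (N + 2))
    (hq : q.InList (N + 2)) (h : IsoOrAntiIso (T (N + 2) p) (T (N + 2) q)) : p = q := by
  refine hp.eq_of_pat_eq hN hq ?_
  obtain ⟨f, hf⟩ := h.exists_equiv
  have vp := hp.valid hN
  have vq := hq.valid hN
  have mp := p.model hN vp
  have mq := q.model hN vq
  rcases mp.map_gen hN mq hf with ⟨ha, hb⟩ | ⟨ha, hb⟩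
  · rcases hf with hf | hf
    · exact mp.pat_eq_of_hom hN vp vq mq hf ha hb
    · refine (mp.pat_eq_of_antiHom hN vp vq mq hf ha hb).resolve_right ?_
      rintro ⟨i, j, m, m', hij, h1, h2⟩
      exact hij (le_antisymm (hq.le_of_pat_eq h2) (hp.le_of_pat_eq h1))
  · exact mp.pat_eq_of_swap hN vp vq mq hf ha hb

theorem Name.comm_or_eq_of_isSelfDual {N : ℕ} (hN : 5 ≤ N) {p : Name} (hp : p.InList (N + 2))
    (h : IsSelfDual (T (N + 2) p)) :
    (∀ x y : T (N + 2) p, x * y = y * x) ∨ p = .T5 2 := by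
  obtain ⟨f'⟩ := h
  obtain ⟨f, hf⟩ : ∃ f : T (N + 2) p ≃ T (N + 2) p, ∀ s t, f (s * t) = f t * f s :=
    ⟨f'.toEquiv.trans MulOpposite.opEquiv.symm,
      fun s t => congrArg MulOpposite.unop (f'.map_mul s t)⟩
  have vp := hp.valid hN
  have mp := p.model hN vp
  have hcomm : (p.pat (N + 2)).sig.uv = (p.pat (N + 2)).sig.vu →
      ∀ x y : T (N + 2) p, x * y = y * x :=
    fun h => mul_comm_of_closure_pair mp.gen (mp.mul_comm_iff.2 h)
  rcases mp.map_gen hN mp (Or.inr hf) with ⟨ha, hb⟩ | ⟨ha, hb⟩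
  · exact Or.inl (hcomm (mp.sig_eq_of_antiHom mp hf ha hb).1)
  · rcases mp.isSymm_of_swap hN vp mp (Or.inr hf) hb with hP | hP | hP | hP
    · exact Or.inl (hcomm (by rw [hP]; rfl))
    -- Here v² = uv. The anti-automorphism exchanging the generators fixes uv and sends v² to u², so
    -- uv = u², although uv is the element `x`.
    · have hr := mp.rules
      have h1 := hr.uv
      have h2 := hr.vv
      have h3 : f (p.genV (N + 2) * p.genV (N + 2)) = _ := hf _ _
      have h4 : f (p.genU (N + 2) * p.genV (N + 2)) = _ := hf _ _
      rw [ha, hb] at h4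
      rw [hb] at h3
      rw [h2] at h3
      rw [h1] at h4
      rw [hP] at h1 h2 h3 h4
      have h5 : p.genU (N + 2) * p.genV (N + 2) = p.genU (N + 2) * p.genU (N + 2) :=
        h4.symm.trans h3
      rw [h1] at h5
      have := mp.spow_ne_x 2 (by omega)
      rw [hP] at this
      exact absurd h5.symm this
    · exact Or.inl (hcomm (by rw [hP]; rfl))
    · right
      have hq : (Name.T5 2).InList (N + 2) := by simp only [Name.InList]; omega
      exact hp.eq_of_pat_eq hN hq hP

theorem bijective_of_surjective_of_card_eq {S S' : Type*} {n : ℕ} (hn : n ≠ 0) {g : S → S'}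
    (hg : Function.Surjective g) (hS : Nat.card S = n) (hS' : Nat.card S' = n) :
    Function.Bijective g := by
  have : Finite S := Nat.finite_of_card_ne_zero (by omega)
  exact (Nat.bijective_iff_surjective_and_card g).2 ⟨hg, hS.trans hS'.symm⟩

/-- The semigroup is determined by its order and the relations. -/
theorem Name.nonempty_mulEquiv {S : Type*} [Semigroup S] {N : ℕ} (hN : 5 ≤ N) {p : Name}
    (hp : (p.pat (N + 2)).Valid N) {a b : S} (h : (p.pat (N + 2)).Sat N a b)
    (hgen : Subsemigroup.closure {a, b} = ⊤) (hcard : Nat.card S = N + 2) :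
    Nonempty (T (N + 2) p ≃* S) := by
  obtain ⟨g, hga, hgb⟩ := p.exists_hom h
  have hsurj : Function.Surjective g := by
    intro s
    have hs : s ∈ Subsemigroup.closure {a, b} := hgen ▸ Subsemigroup.mem_top s
    induction hs using Subsemigroup.closure_induction with
    | mem s hs =>
      rcases hs with rfl | rfl
      · exact ⟨_, hga⟩
      · exact ⟨_, hgb⟩
    | mul s t _ _ hs ht =>
      obtain ⟨s, rfl⟩ := hs
      obtain ⟨t, rfl⟩ := ht
      exact ⟨s * t, map_mul g s t⟩
  exact ⟨MulEquiv.ofBijective g (bijective_of_surjective_of_card_eq (by omega) hsurj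
    ((p.model hN hp).card hN) hcard)⟩

theorem closure_op_pair {S : Type*} [Semigroup S] {a b : S}
    (h : Subsemigroup.closure {a, b} = ⊤) :
    Subsemigroup.closure {MulOpposite.op a, MulOpposite.op b} = ⊤ := by
  refine eq_top_iff.2 fun s _ => ?_
  have hs : s.unop ∈ Subsemigroup.closure {a, b} := h ▸ Subsemigroup.mem_top _
  rw [← MulOpposite.op_unop s]
  generalize s.unop = s at hs
  induction hs using Subsemigroup.closure_induction with
  | mem s hs =>
    apply Subsemigroup.subset_closure
    rcases hs with rfl | rfl
    · exact Or.inl rfl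
    · exact Or.inr rfl
  | mul s t _ _ hs ht => rw [MulOpposite.op_mul]; exact mul_mem ht hs

/-- The relations amount to uv = u² = v² and vu² = u³, so v^k = u^k for k ≥ 3. They therefore hold
again in the dual with the generators exchanged. -/
theorem Name.isSelfDual_T5_two {N : ℕ} (hN : 5 ≤ N) : IsSelfDual (T (N + 2) (.T5 2)) := by
  have hin : (Name.T5 2).InList (N + 2) := by simp only [Name.InList]; omega
  have hv := hin.valid hN
  have hm := (Name.T5 2).model hN hv
  obtain ⟨hs, h1, h2, h3⟩ := (Name.T5 2).sat_gen N
  have hgen := closure_op_pair hm.gen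
  rw [Set.pair_comm] at hgen
  refine Name.nonempty_mulEquiv hN hv ?_ hgen ?_
  · have h2' : (Name.T5 2).genV (N + 2) * (Name.T5 2).genV (N + 2) =
      (Name.T5 2).genU (N + 2) * (Name.T5 2).genU (N + 2) := h2
    have hpow : ∀ k, 3 ≤ k →
        spow ((Name.T5 2).genV (N + 2)) k = spow ((Name.T5 2).genU (N + 2)) k := by
      intro k hk
      induction k, hk using Nat.le_induction with
      | base => rw [← h3, ← h2', ← mul_assoc]; rfl
      | succ k hk ih =>
        rw [spow_succ' _ (by omega), ih, mul_spow_of_mul_mul (by omega) h3 (by omega)]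
        rfl
    refine ⟨?_, ?_, ?_, ?_⟩
    · rw [← op_spow, ← op_spow, hpow _ (by omega), hpow _ (by omega), hs]
    · rw [← op_spow, ← MulOpposite.op_mul]
      exact congrArg MulOpposite.op (h1.trans h2.symm)
    · rw [← op_spow, ← MulOpposite.op_mul]
      exact congrArg MulOpposite.op h2.symm
    · rw [← op_spow, ← MulOpposite.op_mul, ← MulOpposite.op_mul]
      refine congrArg MulOpposite.op ?_
      rw [h2', ← spow_three]
      exact (hpow 3 le_rfl).symm
  · rw [Nat.card_congr MulOpposite.opEquiv.symm, hm.card hN]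

theorem isSelfDual_of_comm {S : Type*} [Semigroup S] (h : ∀ x y : S, x * y = y * x) :
    IsSelfDual S :=
  ⟨⟨MulOpposite.opEquiv, fun x y => by
    change MulOpposite.op (x * y) = MulOpposite.op x * MulOpposite.op y
    rw [← MulOpposite.op_mul, h]⟩⟩

/-! ### Sizes of the layers S^(k+1) \ S^(k+2) -/

section Layers

variable {S : Type*} [Semigroup S]

theorem mem_powSucc_succ' {k : ℕ} {s : S} :
    s ∈ powSucc S (k + 1) ↔ ∃ t, ∃ y ∈ powSucc S k, t * y = s := by
  induction k generalizing s with
  | zero =>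
    rw [mem_powSucc_succ]
    constructor
    · rintro ⟨y, -, t, rfl⟩
      exact ⟨y, t, Set.mem_univ _, rfl⟩
    · rintro ⟨t, y, -, rfl⟩
      exact ⟨t, Set.mem_univ _, y, rfl⟩
  | succ k ih =>
    rw [mem_powSucc_succ]
    constructor
    · rintro ⟨y, hy, r, rfl⟩
      obtain ⟨t, w, hw, rfl⟩ := ih.1 hy
      exact ⟨t, w * r, mem_powSucc_succ.2 ⟨w, hw, r, rfl⟩, (mul_assoc _ _ _).symm⟩
    · rintro ⟨t, y, hy, rfl⟩
      obtain ⟨w, hw, r, rfl⟩ := mem_powSucc_succ.1 hy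
      exact ⟨t * w, ih.2 ⟨t, w, hw, rfl⟩, r, mul_assoc _ _ _⟩

theorem mul_mem_powSucc_left {k : ℕ} {s : S} (hs : s ∈ powSucc S k) (t : S) :
    s * t ∈ powSucc S (k + 1) := mem_powSucc_succ.2 ⟨s, hs, t, rfl⟩

theorem mul_mem_powSucc_right {k : ℕ} {s : S} (hs : s ∈ powSucc S k) (t : S) :
    t * s ∈ powSucc S (k + 1) := mem_powSucc_succ'.2 ⟨t, s, hs, rfl⟩

/-- The elements of `S^(k+1)` outside `S^(k+2)`. -/
def layer (S : Type*) [Mul S] (k : ℕ) : Set S := powSucc S k \ powSucc S (k + 1)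

/-- If a layer has at most one element `s * y`, the next one has at most the element
`s * (s * y)`. -/
theorem layer_succ_subset {k : ℕ} {s y : S} (hy : y ∈ powSucc S k)
    (h : layer S (k + 1) ⊆ {s * y}) : layer S (k + 2) ⊆ {s * (s * y)} := by
  rintro z ⟨hz, hz'⟩
  obtain ⟨w, hw, t, rfl⟩ := mem_powSucc_succ.1 hz
  -- A factor lying deeper than expected would push the product `z` out of its layer; this pins down
  -- `w` here and `y * t` below.
  obtain rfl : w = s * y := h ⟨hw, fun hw' => hz' (mul_mem_powSucc_left hw' t)⟩
  rw [mul_assoc] at hz'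
  have : y * t = s * y :=
    h ⟨mul_mem_powSucc_left hy t, fun hw' => hz' (mul_mem_powSucc_right hw' s)⟩
  rw [mul_assoc, this]
  rfl

theorem layer_subsingleton_succ {k : ℕ} (h : (layer S (k + 1)).Subsingleton) :
    (layer S (k + 2)).Subsingleton := by
  intro z hz z' hz'
  obtain ⟨w, hw, t, rfl⟩ := mem_powSucc_succ.1 hz.1
  have hwl : w ∈ layer S (k + 1) := ⟨hw, fun hw' => hz.2 (mul_mem_powSucc_left hw' t)⟩
  obtain ⟨s, y, hy, rfl⟩ := mem_powSucc_succ'.1 hw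
  have hsub := layer_succ_subset hy fun r hr => h hr hwl
  exact (hsub hz : _ = _).trans (hsub hz' : _ = _).symm

theorem layer_one_subsingleton (h : (layer S 0).Subsingleton) : (layer S 1).Subsingleton := by
  have key : ∀ s t : S, s * t ∈ layer S 1 → s ∈ layer S 0 ∧ t ∈ layer S 0 := fun s t hst =>
    ⟨⟨Set.mem_univ _, fun hs => hst.2 (mul_mem_powSucc_left hs t)⟩,
      ⟨Set.mem_univ _, fun ht => hst.2 (mul_mem_powSucc_right ht s)⟩⟩
  intro z hz z' hz'
  obtain ⟨s, -, t, rfl⟩ := mem_powSucc_succ.1 hz.1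
  obtain ⟨s', -, t', rfl⟩ := mem_powSucc_succ.1 hz'.1
  rw [h (key _ _ hz).1 (key _ _ hz').1, h (key _ _ hz).2 (key _ _ hz').2]

theorem ncard_powSucc_eq [Finite S] (k : ℕ) :
    (powSucc S k).ncard = (powSucc S (k + 1)).ncard + (layer S k).ncard := by
  rw [layer, add_comm, Set.ncard_sdiff_add_ncard_of_subset (powSucc_succ_subset k)]

/-- Once two consecutive terms of the series agree it is constant, so it would have reached one
element too early. -/
theorem layer_nonempty {N : ℕ} (hmin : ∀ k, k < N - 1 → (powSucc S k).ncard ≠ 1)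
    (hone : (powSucc S (N - 1)).ncard = 1) {k : ℕ} (hk : k < N - 1) : (layer S k).Nonempty := by
  by_contra hne
  have heq : powSucc S (k + 1) = powSucc S k :=
    (powSucc_succ_subset k).antisymm (Set.sdiff_eq_empty.1 (Set.not_nonempty_iff_eq_empty.1 hne))
  have hall : ∀ m, k ≤ m → powSucc S m = powSucc S k := by
    intro m hm
    induction m, hm using Nat.le_induction with
    | base => rfl
    | succ m hm ih =>
      rw [← heq]
      change powSucc S m * _ = powSucc S k * _
      rw [ih]
  exact hmin k hk (by rw [← hall _ hk.le, hone])

theorem le_ncard_powSucc [Finite S] {N : ℕ} (hmin : ∀ k, k < N - 1 → (powSucc S k).ncard ≠ 1)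
    (hone : (powSucc S (N - 1)).ncard = 1) {m k : ℕ} (hk : k + m = N - 1) :
    m + 1 ≤ (powSucc S k).ncard := by
  induction m generalizing k with
  | zero => rw [show k = N - 1 by omega, hone]
  | succ m ih =>
    have h1 := ih (k := k + 1) (by omega)
    have h2 := (Set.ncard_pos).2 (layer_nonempty hmin hone (show k < N - 1 by omega))
    have h3 := ncard_powSucc_eq (S := S) k
    omega

theorem ncard_powSucc_le [Finite S] {N : ℕ} (hone : (powSucc S (N - 1)).ncard = 1)
    (hs : (layer S 1).Subsingleton) {m k : ℕ} (hk1 : 1 ≤ k) (hk : k + m = N - 1) :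
    (powSucc S k).ncard ≤ m + 1 := by
  have hall : ∀ k, 1 ≤ k → (layer S k).Subsingleton := by
    intro k hk
    induction k, hk using Nat.le_induction with
    | base => exact hs
    | succ k hk ih =>
      obtain ⟨k, rfl⟩ := Nat.exists_eq_add_of_le' hk
      exact layer_subsingleton_succ ih
  induction m generalizing k with
  | zero => rw [show k = N - 1 by omega, hone]
  | succ m ih =>
    have h1 := ih (k := k + 1) (by omega) (by omega)
    have h2 := Set.ncard_le_one_iff_subsingleton.2 (hall k hk1)
    have h3 := ncard_powSucc_eq (S := S) k
    omega

/-- The structure of a nilpotent semigroup of order `N + 2` and coclass `2` generated by two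
elements `a` and `b`, where `a` has a nonzero power of maximal exponent. -/
structure Layered {S : Type*} [Semigroup S] (N : ℕ) (a b x : S) : Prop where
  gen : Subsemigroup.closure {a, b} = ⊤
  stab : spow a N = spow a (N + 1)
  inj : ∀ i j, 1 ≤ i → 1 ≤ j → spow a i = spow a j → i = j ∨ N ≤ i ∧ N ≤ j
  triple : ∀ s t r : S, ∃ k, 3 ≤ k ∧ k ≤ N ∧ s * t * r = spow a k
  x_ne : ∀ i, 1 ≤ i → x ≠ spow a i
  ab : a * b = x ∨ ∃ k, 2 ≤ k ∧ k ≤ N ∧ a * b = spow a k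
  ba : b * a = x ∨ ∃ k, 2 ≤ k ∧ k ≤ N ∧ b * a = spow a k
  bb : b * b = x ∨ ∃ k, 2 ≤ k ∧ k ≤ N ∧ b * b = spow a k
  exists_eq_x : a * b = x ∨ b * a = x ∨ b * b = x

theorem exists_layered {N : ℕ} (hN : 5 ≤ N) (h : IsCoclassTwoTwoGenerated (N + 2) S) :
    ∃ a b x : S, Layered N a b x := by
  obtain ⟨hcard, ⟨hfin, hnil, hcl⟩, A, hA, hA2⟩ := h
  have hc : nilpotencyClass S = N - 1 := by omega
  have hone : (powSucc S (N - 1)).ncard = 1 := hc ▸ Nat.sInf_mem hnil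
  have hmin : ∀ k, k < N - 1 → (powSucc S k).ncard ≠ 1 := fun k hk hk1 =>
    absurd (Nat.sInf_le (s := {c : ℕ | (powSucc S c).ncard = 1}) hk1) (by
      change ¬ nilpotencyClass S ≤ k
      omega)
  have hd0 : (powSucc S 0).ncard = N + 2 := by rw [powSucc, Set.ncard_univ, hcard]
  have e0 : (powSucc S 0).ncard = (powSucc S 1).ncard + (layer S 0).ncard := ncard_powSucc_eq 0
  have e1 : (powSucc S 1).ncard = (powSucc S 2).ncard + (layer S 1).ncard := ncard_powSucc_eq 1
  have e2 : (powSucc S 2).ncard = (powSucc S 3).ncard + (layer S 2).ncard := ncard_powSucc_eq 2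
  have l2 := le_ncard_powSucc hmin hone (show 2 + (N - 3) = N - 1 by omega)
  have l3 := le_ncard_powSucc hmin hone (show 3 + (N - 4) = N - 1 by omega)
  have hsub : layer S 0 ⊆ A := fun c hc => mem_of_closure_eq_top hA.prop fun s t hst =>
    hc.2 (mem_powSucc_succ.2 ⟨s, Set.mem_univ _, t, hst⟩)
  have c0 : (layer S 0).ncard ≤ 2 :=
    hA2 ▸ Set.ncard_le_ncard hsub (Set.finite_of_ncard_pos (by omega))
  -- If the second layer had at most one element, so would all later ones. Then |S^2| ≤ N - 1,
  -- leaving at least three elements in the first layer.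
  have n1 : ¬ (layer S 1).Subsingleton := by
    intro hs
    have := ncard_powSucc_le hone hs le_rfl (show 1 + (N - 2) = N - 1 by omega)
    omega
  have n0 : ¬ (layer S 0).Subsingleton := fun hs => n1 (layer_one_subsingleton hs)
  rw [← Set.ncard_le_one_iff_subsingleton] at n0 n1
  have s2 : (layer S 2).Subsingleton := Set.ncard_le_one_iff_subsingleton.1 (by omega)
  -- the generator whose cube spans the third layer
  obtain ⟨w, hw⟩ := layer_nonempty hmin hone (show 2 < N - 1 by omega)
  obtain ⟨a, y, hy, rfl⟩ := mem_powSucc_succ'.1 hw.1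
  obtain ⟨t, -, r, rfl⟩ := mem_powSucc_succ.1 hy
  have hl3 := layer_succ_subset hy fun z hz => s2 hz hw
  -- The word `a * (t * r)` represents the third layer, and its left multiple by `a` represents the
  -- fourth. So any length-three prefix of a word equal to that multiple also lies in the third
  -- layer, which has one element. This gives first aat and then aaa.
  have haw : a * (a * (t * r)) ∉ powSucc S 4 := by
    obtain ⟨z, hz⟩ := layer_nonempty hmin hone (show 3 < N - 1 by omega)
    have : z = _ := hl3 hz
    exact this ▸ hz.2
  have mem2 : ∀ p q r : S, p * q * r ∈ powSucc S 2 := fun p q r =>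
    mul_mem_powSucc_left (mul_mem_powSucc_left (Set.mem_univ p) q) r
  have h1 : a * a * t = a * (t * r) := s2 ⟨mem2 _ _ _, fun hm => haw (by
    have := mul_mem_powSucc_left hm r
    simpa only [mul_assoc] using this)⟩ hw
  have h2 : a * a * a = a * (t * r) := s2 ⟨mem2 _ _ _, fun hm => haw (by
    have := mul_mem_powSucc_left hm t
    rw [← h1]
    simpa only [mul_assoc] using this)⟩ hw
  have hlay : ∀ k, 2 ≤ k → layer S k ⊆ {spow a (k + 1)} := by
    intro k hk
    induction k, hk using Nat.le_induction with
    | base => exact fun z hz => (s2 hz hw).trans h2.symm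
    | succ k hk ih =>
      obtain ⟨k, rfl⟩ := Nat.exists_eq_add_of_le' (show 1 ≤ k by omega)
      rw [spow_succ' a (by omega)] at ih
      rw [spow_succ' a (by omega), spow_succ' a (by omega)]
      exact layer_succ_subset (spow_mem_powSucc a k) ih
  have hnot2 : ∀ k, 2 ≤ k → k < N - 1 → spow a (k + 1) ∉ powSucc S (k + 1) := by
    intro k hk hkN
    obtain ⟨z, hz⟩ := layer_nonempty hmin hone hkN
    have : z = _ := hlay k hk hz
    exact this ▸ hz.2
  -- For k = 0 and k = 1, multiplying up to a³ reduces to the case k = 2.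
  have hnot : ∀ k, k < N - 1 → spow a (k + 1) ∉ powSucc S (k + 1) := by
    have n2 := hnot2 2 le_rfl (by omega)
    intro k hk hmem
    match k with
    | 0 => exact n2 (mul_mem_powSucc_left (mul_mem_powSucc_left hmem a) a)
    | 1 => exact n2 (mul_mem_powSucc_left hmem a)
    | k + 2 => exact hnot2 _ (by omega) hk hmem
  obtain ⟨z, hz⟩ := Set.ncard_eq_one.1 hone
  have hzN : spow a N = z := by
    have := spow_mem_powSucc a (N - 1)
    rw [hz, Nat.sub_add_cancel (by omega)] at this
    exact this
  have hzN' : spow a (N + 1) = z := by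
    have := powSucc_antitone (show N - 1 ≤ N by omega) (spow_mem_powSucc a N)
    rw [hz] at this
    exact this
  have hpow : ∀ m k, k + m = N - 1 → 2 ≤ k → ∀ s ∈ powSucc S k,
      ∃ i, 3 ≤ i ∧ i ≤ N ∧ s = spow a i := by
    intro m
    induction m with
    | zero =>
      intro k hk _ s hs
      rw [show k = N - 1 by omega, hz] at hs
      exact ⟨N, by omega, le_rfl, hs.trans hzN.symm⟩
    | succ m ih =>
      intro k hk hk2 s hs
      by_cases hs' : s ∈ powSucc S (k + 1)
      · exact ih (k + 1) (by omega) (by omega) s hs'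
      · exact ⟨k + 1, by omega, by omega, hlay k hk2 ⟨hs, hs'⟩⟩
  have hinj : ∀ i j, 1 ≤ i → i < j → i < N → spow a i ≠ spow a j := by
    intro i j hi hij hiN heq
    obtain ⟨i, rfl⟩ := Nat.exists_eq_add_of_le' hi
    obtain ⟨j, rfl⟩ := Nat.exists_eq_add_of_le' (show 1 ≤ j by omega)
    exact hnot i (by omega) (heq ▸ powSucc_antitone (show i + 1 ≤ j by omega)
      (spow_mem_powSucc a j))
  -- the second generator
  have ha0 : a ∈ layer S 0 := ⟨Set.mem_univ _, hnot 0 (by omega)⟩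
  obtain ⟨b, hb0, hba⟩ := Set.exists_ne_of_one_lt_ncard (not_le.1 n0) a
  have hlay0 : layer S 0 = {a, b} := by
    refine (Set.eq_of_subset_of_ncard_le ?_ ?_).symm
    · rintro c (rfl | rfl) <;> assumption
    · rw [Set.ncard_pair hba.symm]
      exact c0
  have hAab : {a, b} = A := by
    refine Set.eq_of_subset_of_ncard_le (hlay0 ▸ hsub) ?_ (Set.finite_of_ncard_pos (by omega))
    rw [Set.ncard_pair hba.symm, hA2]
  -- the second element of the second layer
  have haa : a * a ∈ layer S 1 := ⟨spow_mem_powSucc a 1, hnot 1 (by omega)⟩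
  obtain ⟨x, hx, hxa⟩ := Set.exists_ne_of_one_lt_ncard (not_le.1 n1) (a * a)
  have hlay1 : layer S 1 = {a * a, x} := by
    refine (Set.eq_of_subset_of_ncard_le ?_ ?_).symm
    · rintro c (rfl | rfl) <;> assumption
    · rw [Set.ncard_pair hxa.symm]
      omega
  have hprod : ∀ s t : S, s * t = x ∨ ∃ k, 2 ≤ k ∧ k ≤ N ∧ s * t = spow a k := by
    intro s t
    by_cases hst : s * t ∈ powSucc S 2
    · obtain ⟨k, hk, hkN, h⟩ := hpow (N - 3) 2 (by omega) le_rfl _ hst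
      exact Or.inr ⟨k, by omega, hkN, h⟩
    · have : s * t ∈ layer S 1 := ⟨mul_mem_powSucc_left (Set.mem_univ s) t, hst⟩
      rw [hlay1] at this
      rcases this with h | h
      · exact Or.inr ⟨2, le_rfl, by omega, h⟩
      · exact Or.inl h
  refine ⟨a, b, x, hAab ▸ hA.prop, hzN.trans hzN'.symm, ?_, ?_, ?_, hprod a b, hprod b a,
    hprod b b, ?_⟩
  · intro i j hi hj hij
    by_contra hcon
    rcases lt_trichotomy i j with h | h | h
    · exact hinj i j hi h (by omega) hij
    · exact hcon (Or.inl h)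
    · exact hinj j i hj h (by omega) hij.symm
  · exact fun s t r => hpow (N - 3) 2 (by omega) le_rfl _ (mem2 s t r)
  · intro i hi hxi
    match i with
    | 1 => exact hnot 0 (by omega) (hxi ▸ hx.1)
    | 2 => exact hxa hxi
    | i + 3 => exact hx.2 (hxi ▸ powSucc_antitone (show 2 ≤ i + 2 by omega)
        (spow_mem_powSucc a (i + 2)))
  · obtain ⟨s, -, t, hst⟩ := mem_powSucc_succ.1 hx.1
    have hs : s ∈ layer S 0 := ⟨Set.mem_univ _, fun hs => hx.2 (hst ▸ mul_mem_powSucc_left hs t)⟩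
    have ht : t ∈ layer S 0 := ⟨Set.mem_univ _, fun ht => hx.2 (hst ▸ mul_mem_powSucc_right ht s)⟩
    rw [hlay0] at hs ht
    rcases hs with rfl | rfl <;> rcases ht with rfl | rfl
    · exact absurd hst.symm hxa
    · exact Or.inl hst
    · exact Or.inr (Or.inl hst)
    · exact Or.inr (Or.inr hst)

end Layers
-- Constraints from associativity
section Analysis

variable {S : Type*} [Semigroup S] {N : ℕ} {a b x : S}

theorem Layered.op (h : Layered N a b x) :
    Layered N (MulOpposite.op a) (MulOpposite.op b) (MulOpposite.op x) := by
  have hop : ∀ {s t r : S}, (s * t = r ∨ ∃ k, 2 ≤ k ∧ k ≤ N ∧ s * t = spow a k) →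
      MulOpposite.op t * MulOpposite.op s = MulOpposite.op r ∨ ∃ k, 2 ≤ k ∧ k ≤ N ∧
        MulOpposite.op t * MulOpposite.op s = spow (MulOpposite.op a) k := by
    rintro s t r (h | ⟨k, hk, hkN, h⟩)
    · exact Or.inl (congrArg MulOpposite.op h)
    · exact Or.inr ⟨k, hk, hkN, by rw [← op_spow, ← h, MulOpposite.op_mul]⟩
  refine ⟨closure_op_pair h.gen, ?_, ?_, ?_, ?_, hop h.ba, hop h.ab, hop h.bb, ?_⟩
  · rw [← op_spow, ← op_spow, h.stab]
  · intro i j hi hj hij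
    rw [← op_spow, ← op_spow] at hij
    exact h.inj i j hi hj (MulOpposite.op_injective hij)
  · intro s t r
    obtain ⟨k, hk, hkN, h⟩ := h.triple r.unop t.unop s.unop
    refine ⟨k, hk, hkN, ?_⟩
    rw [← op_spow, ← h, mul_assoc]
    rfl
  · intro i hi hx
    rw [← op_spow] at hx
    exact h.x_ne i hi (MulOpposite.op_injective hx)
  · rcases h.exists_eq_x with h | h | h
    · exact Or.inr (Or.inl (congrArg MulOpposite.op h))
    · exact Or.inl (congrArg MulOpposite.op h)
    · exact Or.inr (Or.inr (congrArg MulOpposite.op h))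

theorem Layered.sat_P1 (h : Layered N a b x) (hab : a * b = x) (hba : b * a = x)
    (hbb : b * b = x) :
    (∃ m, (Pat.P1 m).Valid N ∧ (Pat.P1 m).Sat N a b) ∨ (Pat.P4 2 2 3).Sat N b a := by
  obtain ⟨k, hk, hkN, hk'⟩ := h.triple a a b
  have hcomm : a * b = b * a := hab.trans hba.symm
  have hsq : b * b = a * b := hbb.trans hab.symm
  have hb3 : b * b * b = spow a k := by rw [hsq, mul_assoc, hsq, ← mul_assoc, hk']
  have hbaa : b * (a * a) = spow a k := by rw [← mul_assoc, ← hcomm, mul_assoc, ← hcomm,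
    ← mul_assoc, hk']
  -- Both sides equal b⁴: b³a = b²·ba = b⁴ and a^k b = b³·b.
  have key : spow a (k + 1) = spow a (k + k - 2) := by
    rw [← spow_mul_of_mul_mul hk hk' (by omega), ← hb3, spow_succ _ (by omega), ← hb3,
      mul_assoc (b * b), ← hcomm, ← hsq, ← mul_assoc]
  rcases h.inj _ _ (by omega) (by omega) key with h1 | h1
  · obtain rfl : k = 3 := by omega
    right
    have hpow : ∀ m, 3 ≤ m → spow b m = spow a m := by
      intro m hm
      induction m, hm using Nat.le_induction with
      | base => exact hb3
      | succ m hm ih =>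
        rw [spow_succ' _ (by omega), ih, mul_spow_of_mul_mul le_rfl hbaa (by omega)]
        rfl
    have hN : 3 ≤ N := hkN
    exact ⟨by rw [hpow _ hN, hpow _ (by omega), h.stab], hba.trans hbb.symm,
      hab.trans hbb.symm, (hpow 3 le_rfl).symm⟩
  · exact Or.inl ⟨k, ⟨h1.1, hkN⟩, h.stab, hcomm, hsq, hb3⟩

theorem Layered.sat_P2 (h : Layered N a b x) (hab : a * b = x) (hba : b * a = x) {j : ℕ}
    (hj : 2 ≤ j) (hjN : j ≤ N) (hbb : b * b = spow a j) :
    ∃ k, (Pat.P2 j k).Valid N ∧ (Pat.P2 j k).Sat N a b := by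
  obtain ⟨k, hk, hkN, hk'⟩ := h.triple a a b
  have hcomm : a * b = b * a := hab.trans hba.symm
  have hbaa : b * (a * a) = spow a k := by rw [← mul_assoc, ← hcomm, mul_assoc, ← hcomm,
    ← mul_assoc, hk']
  -- The word b²a² evaluated in two ways.
  have key : spow a (j + 2) = spow a (k + k - 2) := by
    rw [← mul_spow_of_mul_mul hk hbaa (by omega), ← hbaa, ← mul_assoc, hbb,
      spow_add a (by omega) (by omega), spow_two]
  have h1 := h.inj _ _ (by omega) (by omega) key
  exact ⟨k, ⟨hj, hjN, hk, hkN, by omega⟩, h.stab, hcomm, hbb, hk'⟩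

theorem Layered.sat_P3 (hN : 5 ≤ N) (h : Layered N a b x) (hab : a * b = x) (hbb : b * b = x)
    {j : ℕ} (hj : 2 ≤ j) (hjN : j ≤ N) (hba : b * a = spow a j) :
    ∃ k, (Pat.P3 j k).Valid N ∧ (Pat.P3 j k).Sat N a b := by
  obtain ⟨k, hk, hkN, hk'⟩ := h.triple a a b
  have hsq : b * b = a * b := hbb.trans hab.symm
  have habb : a * (b * b) = spow a k := by rw [hsq, ← mul_assoc, hk']
  have hbaa : b * (a * a) = spow a (j + 1) := by rw [← mul_assoc, hba, spow_succ _ (by omega)]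
  -- The three equations come from the words bab, b²a and a²ba.
  have key1 : spow a k = spow a (j + k - 2) := by
    rw [← spow_mul_of_mul_mul hk hk' hj, ← hba, mul_assoc, ← hsq, ← mul_assoc, hsq, mul_assoc,
      habb]
  have key2 : spow a (j + 1) = spow a (j + (j + 1) - 2) := by
    rw [← mul_spow_of_mul_mul (by omega) hbaa hj, ← hba, ← mul_assoc, hsq, mul_assoc, hba,
      spow_succ' _ (by omega)]
  have key3 : spow a (k + 1) = spow a (2 + j) := by
    rw [spow_succ _ (by omega), ← hk', mul_assoc, hba, spow_add a (by omega) (by omega), spow_two]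
  have h1 := h.inj _ _ (by omega) (by omega) key1
  have h2 := h.inj _ _ (by omega) (by omega) key2
  have h3 := h.inj _ _ (by omega) (by omega) key3
  refine ⟨k, ?_, h.stab, hsq, hba, habb⟩
  simp only [Pat.Valid]
  omega

theorem Layered.sat_P4 (h : Layered N a b x) {i j : ℕ}
    (hi : 2 ≤ i) (hiN : i ≤ N) (hab : a * b = spow a i)
    (hj : 2 ≤ j) (hjN : j ≤ N) (hba : b * a = spow a j) :
    ∃ m, (Pat.P4 i j m).Valid N ∧ (Pat.P4 i j m).Sat N a b := by
  obtain ⟨m, hm, hmN, hm'⟩ := h.triple b b b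
  have haab : a * a * b = spow a (i + 1) := by rw [mul_assoc, hab, spow_succ' _ (by omega)]
  -- The word aba gives this equation, and ab³ gives the next.
  have key1 : spow a (i + 1) = spow a (j + 1) := by
    rw [spow_succ _ (by omega), ← hab, mul_assoc, hba, ← spow_succ' _ (by omega)]
  have key2 : spow a (m + 1) = spow a (i + (i + 1) - 2 + (i + 1) - 2) := by
    rw [← spow_mul_of_mul_mul (by omega) haab (by omega),
      ← spow_mul_of_mul_mul (by omega) haab hi, ← hab, spow_succ' _ (by omega), ← hm']
    simp only [mul_assoc]
  have h1 := h.inj _ _ (by omega) (by omega) key1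
  have h2 := h.inj _ _ (by omega) (by omega) key2
  exact ⟨m, ⟨hi, hiN, hj, hjN, hmN, by omega, by omega⟩, h.stab, hab, hba, hm'⟩

theorem Layered.sat_P5 (h : Layered N a b x) {i j : ℕ}
    (hi : 2 ≤ i) (hiN : i ≤ N) (hab : a * b = spow a i)
    (hj : 2 ≤ j) (hjN : j ≤ N) (hbb : b * b = spow a j) :
    ∃ m, (Pat.P5 i j m).Valid N ∧ (Pat.P5 i j m).Sat N a b := by
  obtain ⟨m, hm, hmN, hm'⟩ := h.triple b a a
  rw [mul_assoc] at hm'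
  have haab : a * a * b = spow a (i + 1) := by rw [mul_assoc, hab, spow_succ' _ (by omega)]
  -- The word aba² gives this equation, and ab² gives the next.
  have key1 : spow a (m + 1) = spow a (i + 2) := by
    rw [spow_succ' _ (by omega), ← hm', ← mul_assoc, hab, spow_add a (by omega) (by omega),
      spow_two]
  have key2 : spow a (j + 1) = spow a (i + (i + 1) - 2) := by
    rw [← spow_mul_of_mul_mul (by omega) haab hi, ← hab, spow_succ' _ (by omega), ← hbb, mul_assoc]
  have h1 := h.inj _ _ (by omega) (by omega) key1
  have h2 := h.inj _ _ (by omega) (by omega) key2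
  exact ⟨m, ⟨hi, hiN, hjN, hm, hmN, by omega, by omega⟩, h.stab, hab, hbb, hm'⟩

/-- The cases record which of ab, ba, b² equal `x`. Passing to the dual handles the mirror images of
`P3` and `P5` and arranges j ≤ i in `P4`. -/
theorem Layered.exists_sat (hN : 5 ≤ N) (h : Layered N a b x) :
    ∃ P : Pat, P.Valid N ∧ (∀ i j m, P = .P4 i j m → j ≤ i) ∧
      (P.Sat N a b ∨ P.Sat N b a ∨ P.Sat N (MulOpposite.op a) (MulOpposite.op b)) := by
  have hop := h.op
  rcases h.ab with hab | ⟨i, hi, hiN, hab⟩ <;> rcases h.ba with hba | ⟨j, hj, hjN, hba⟩ <;>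
    rcases h.bb with hbb | ⟨k, hk, hkN, hbb⟩
  · rcases h.sat_P1 hab hba hbb with ⟨m, hv, hs⟩ | hs
    · exact ⟨_, hv, by simp, Or.inl hs⟩
    · refine ⟨.P4 2 2 3, ⟨le_rfl, by omega, le_rfl, by omega, by omega, Or.inl rfl, Or.inl rfl⟩,
        fun i j m hm => ?_, Or.inr (Or.inl hs)⟩
      simp only [Pat.P4.injEq] at hm
      omega
  · obtain ⟨m, hv, hs⟩ := h.sat_P2 hab hba hk hkN hbb
    exact ⟨_, hv, by simp, Or.inl hs⟩
  · obtain ⟨m, hv, hs⟩ := h.sat_P3 hN hab hbb hj hjN hba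
    exact ⟨_, hv, by simp, Or.inl hs⟩
  · obtain ⟨m, hv, hs⟩ := hop.sat_P5 hj hjN ((congrArg MulOpposite.op hba).trans (op_spow _ _))
      hk hkN ((congrArg MulOpposite.op hbb).trans (op_spow _ _))
    exact ⟨_, hv, by simp, Or.inr (Or.inr hs)⟩
  · obtain ⟨m, hv, hs⟩ := hop.sat_P3 hN (congrArg MulOpposite.op hba)
      (congrArg MulOpposite.op hbb) hi hiN ((congrArg MulOpposite.op hab).trans (op_spow _ _))
    exact ⟨_, hv, by simp, Or.inr (Or.inr hs)⟩
  · obtain ⟨m, hv, hs⟩ := h.sat_P5 hi hiN hab hk hkN hbb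
    exact ⟨_, hv, by simp, Or.inl hs⟩
  · rcases le_total j i with hij | hij
    · obtain ⟨m, hv, hs⟩ := h.sat_P4 hi hiN hab hj hjN hba
      refine ⟨_, hv, fun i' j' m' hm => ?_, Or.inl hs⟩
      simp only [Pat.P4.injEq] at hm
      omega
    · obtain ⟨m, hv, hs⟩ := hop.sat_P4 hj hjN ((congrArg MulOpposite.op hba).trans (op_spow _ _))
        hi hiN ((congrArg MulOpposite.op hab).trans (op_spow _ _))
      refine ⟨_, hv, fun i' j' m' hm => ?_, Or.inr (Or.inr hs)⟩
      simp only [Pat.P4.injEq] at hm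
      omega
  · rcases h.exists_eq_x with hx | hx | hx
    · exact absurd (hx.symm.trans hab) (h.x_ne i (by omega))
    · exact absurd (hx.symm.trans hba) (h.x_ne j (by omega))
    · exact absurd (hx.symm.trans hbb) (h.x_ne k (by omega))

end Analysis

/-! ### Completeness and the main theorem -/

theorem exists_isoOrAntiIso {S : Type*} [Semigroup S] {N : ℕ} (hN : 5 ≤ N)
    (h : IsCoclassTwoTwoGenerated (N + 2) S) :
    ∃ p : Name, p.InList (N + 2) ∧ IsoOrAntiIso S (T (N + 2) p) := by
  obtain ⟨a, b, x, hl⟩ := exists_layered hN h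
  obtain ⟨P, hP, hij, hs⟩ := hl.exists_sat hN
  obtain ⟨p, hp, rfl⟩ := hP.exists_name hN hij
  refine ⟨p, hp, ?_⟩
  rcases hs with hs | hs | hs
  · obtain ⟨f⟩ := Name.nonempty_mulEquiv hN hP hs hl.gen h.1
    exact Or.inl ⟨f.symm⟩
  · obtain ⟨f⟩ := Name.nonempty_mulEquiv hN hP hs (Set.pair_comm a b ▸ hl.gen) h.1
    exact Or.inl ⟨f.symm⟩
  · obtain ⟨f⟩ := Name.nonempty_mulEquiv hN hP hs (closure_op_pair hl.gen)
      ((Nat.card_congr MulOpposite.opEquiv.symm).trans h.1)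
    exact Or.inr ⟨(MulEquiv.opOp S).trans (MulEquiv.op f.symm)⟩

end NilSemigroup

theorem mainTheorem2 (n : ℕ) (hn : 7 ≤ n) :
    -- every semigroup in the list is of the required kind
    (∀ p : NilSemigroup.Name, p.InList n →
      NilSemigroup.IsCoclassTwoTwoGenerated n (NilSemigroup.T n p)) ∧
    -- the list is complete up to (anti-)isomorphism
    (∀ (S : Type*) [Semigroup S], NilSemigroup.IsCoclassTwoTwoGenerated n S →
      ∃ p : NilSemigroup.Name, p.InList n ∧ NilSemigroup.IsoOrAntiIso S (NilSemigroup.T n p)) ∧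
    -- no two different entries of the list are (anti-)isomorphic
    (∀ p q : NilSemigroup.Name, p.InList n → q.InList n →
      NilSemigroup.IsoOrAntiIso (NilSemigroup.T n p) (NilSemigroup.T n q) → p = q) ∧
    -- the self-dual entries are the commutative ones and `T_{5,2}`
    (∀ p : NilSemigroup.Name, p.InList n →
      (NilSemigroup.IsSelfDual (NilSemigroup.T n p) ↔
        ((∀ x y : NilSemigroup.T n p, x * y = y * x) ∨ p = NilSemigroup.Name.T5 2))) := by
  obtain ⟨N, rfl⟩ := Nat.exists_eq_add_of_le' (show 2 ≤ n by omega)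
  have hN : 5 ≤ N := by omega
  refine ⟨fun p hp => (p.model hN (hp.valid hN)).isCoclassTwoTwoGenerated hN,
    fun S _ h => NilSemigroup.exists_isoOrAntiIso hN h,
    fun p q hp hq h => NilSemigroup.Name.eq_of_isoOrAntiIso hN hp hq h, fun p hp => ⟨fun h =>
      NilSemigroup.Name.comm_or_eq_of_isSelfDual hN hp h, ?_⟩⟩
  rintro (h | rfl)
  · exact NilSemigroup.isSelfDual_of_comm h
  · exact NilSemigroup.Name.isSelfDual_T5_two hN
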